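/- Let $M$ be a smooth manifold of odd dimension. On sections of $TM\oplus T^*M$ consider the pairing $\langle X+\alpha,Y+\beta\rangle=\tfrac12(\beta(X)+\alpha(Y))$ and the Courant bracket $[\![X+\alpha,Y+\beta]\!]=[X,Y]+\mathcal L_X\beta-\mathcal L_Y\alpha-\tfrac12 d(\iota_X\beta-\iota_Y\alpha)$, both extended complex-bilinearly to $(TM\oplus T^*M)_{\mathbb C}$, and let $\rho$ be the projection to $TM_{\mathbb C}$. Let $(\Phi,F+\eta)$ be a generalized almost contact pair: $\Phi$ is a smooth bundle endomorphism of $TM\oplus T^*M$, $F$ a smooth vector field and $\eta$ a smooth $1$-form such that $\Phi+\Phi^*=0$ (adjoint with respect to the pairing), $\eta(F)=1$, $\Phi(F)=0$, $\Phi(\eta)=0$ and $\Phi^2(X+\alpha)=-(X+\alpha)+\eta(X)F+\alpha(F)\eta$. Put $$E^{(1,0)}=\{e-i\Phi(e)\mid e\in\ker\eta\oplus\ker F\},\qquad E^{(0,1)}=\{e+i\Phi(e)\mid e\in\ker\eta\oplus\ker F\},$$ $$L=L_F\oplus E^{(1,0)},\qquad L^*=L_\eta\oplus E^{(0,1)},$$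 where $\ker\eta\subset TM$, $\ker F\subset T^*M$ are the pointwise kernels and $L_F$, $L_\eta$ are the complex line bundles spanned by $F$ and $\eta$. Assume that the pair represents a strong generalized contact structure, i.e. both $\Gamma(L)$ and $\Gamma(L^*)$ are closed under the Courant bracket. Then the pair $E^{(1,0)},E^{(0,1)}$ with the induced Courant bracket is a Lie bialgebroid if and only if $d\eta$ vanishes identically on $\ker\eta$, i.e. $d\eta(X,Y)=0$ for all $p\in M$ and all $X,Y\in\ker\eta_p$. Here a pair $A,B$ of complex subbundles of $(TM\oplus T^*M)_{\mathbb C}$ is a Lie bialgebroid with the induced Courant bracket if the pairing puts $A$ and $B$ in duality; $\Gamma(A)$ and $\Gamma(B)$ are closed under the Courant bracket and $A$, $B$ are complex Lie algebroids with the restricted bracket and the anchor $\rho$; and the Lie algebroid differential $d_B$ of $B$, acting on $\Gamma(\wedge^\bullet B^*)=\Gamma(\wedge^\bullet A)$, satisfies $$d_B[\![\omega_1,\omega_2]\!]=[\![d_B\omega_1,\omega_2]\!]+[\![\omega_1,d_B\omega_2]\!]\qquad\text{for all }\omega_1,\omega_2\in\Gamma(A),$$ where the brackets on the right are Schouten brackets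 on $\Gamma(\wedge^\bullet A)$. -/

import Mathlib

open scoped Manifold ContDiff Bundle

/-! ### Complexification of real vector spaces and of bilinear operations -/

/-- The complexification `V ⊗ ℂ = V ⊕ iV` of a real vector space `V`; the element `⟨a, b⟩`
stands for `a + i b`. -/
@[ext]
structure Complexification (V : Type*) where
  re : V
  im : V

namespace Complexification

variable {V : Type*} [AddCommGroup V]

instance : Zero (Complexification V) := ⟨⟨0, 0⟩⟩
instance : Add (Complexification V) := ⟨fun x y => ⟨x.re + y.re, x.im + y.im⟩⟩
instance : Neg (Complexification V) := ⟨fun x => ⟨-x.re, -x.im⟩⟩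

@[simp] theorem zero_re : (0 : Complexification V).re = 0 := rfl
@[simp] theorem zero_im : (0 : Complexification V).im = 0 := rfl
@[simp] theorem add_re (x y : Complexification V) : (x + y).re = x.re + y.re := rfl
@[simp] theorem add_im (x y : Complexification V) : (x + y).im = x.im + y.im := rfl
@[simp] theorem neg_re (x : Complexification V) : (-x).re = -x.re := rfl
@[simp] theorem neg_im (x : Complexification V) : (-x).im = -x.im := rfl

instance : AddCommGroup (Complexification V) where
  add_assoc x y z := by ext <;> simp [add_assoc]
  zero_add x := by ext <;> simp
  add_zero x := by ext <;> simp
  add_comm x y := by ext <;> simp [add_comm]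
  neg_add_cancel x := by ext <;> simp
  nsmul := nsmulRec
  zsmul := zsmulRec

variable [Module ℝ V]

instance : SMul ℂ (Complexification V) :=
  ⟨fun z x => ⟨z.re • x.re - z.im • x.im, z.re • x.im + z.im • x.re⟩⟩

@[simp] theorem smul_re (z : ℂ) (x : Complexification V) :
    (z • x).re = z.re • x.re - z.im • x.im := rfl
@[simp] theorem smul_im (z : ℂ) (x : Complexification V) :
    (z • x).im = z.re • x.im + z.im • x.re := rfl

instance : Module ℂ (Complexification V) where
  one_smul x := by ext <;> simp
  mul_smul a b x := by ext <;> simp <;> module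
  smul_zero a := by ext <;> simp
  smul_add a x y := by ext <;> simp <;> module
  add_smul a b x := by ext <;> simp <;> module
  zero_smul x := by ext <;> simp

/-- The complex-linear extension of a real-linear map. -/
def map {V W : Type*} (T : V → W) (x : Complexification V) : Complexification W :=
  ⟨T x.re, T x.im⟩

/-- The complex-bilinear extension of a real-bilinear map. -/
def bilin {V W U : Type*} [AddCommGroup U] (B : V → W → U)
    (x : Complexification V) (y : Complexification W) : Complexification U :=
  ⟨B x.re y.re - B x.im y.im, B x.re y.im + B x.im y.re⟩

end Complexification

namespace GenContact

/-! ### Real calculus on a manifold -/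

section Real

variable (m : ℕ) (M : Type*) [TopologicalSpace M] [ChartedSpace (EuclideanSpace ℝ (Fin m)) M]

/-- The fibres of the tangent bundle `TM`. -/
abbrev Tan (p : M) : Type := TangentSpace (𝓡 m) p

/-- The fibres of the cotangent bundle `T*M`. -/
abbrev Cot (p : M) : Type := TangentSpace (𝓡 m) p →L[ℝ] ℝ

/-- The fibres of the bundle `TM ⊕ T*M`. -/
abbrev Gen (p : M) : Type := Tan m M p × Cot m M p

/-- (Not necessarily smooth) vector fields. -/
abbrev VField : Type _ := ∀ p : M, Tan m M p

/-- (Not necessarily smooth) one-forms. -/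
abbrev OneForm : Type _ := ∀ p : M, Cot m M p

/-- (Not necessarily smooth) sections of `TM ⊕ T*M`. -/
abbrev GenSection : Type _ := ∀ p : M, Gen m M p

variable {m M}

/-- The differential of a real function. -/
noncomputable def dFun (f : M → ℝ) : OneForm m M := fun p => mfderiv (𝓡 m) 𝓘(ℝ, ℝ) f p

/-- The derivative `X f` of a function along a vector field. -/
noncomputable def derivAlong (X : VField m M) (f : M → ℝ) : M → ℝ := fun p => dFun f p (X p)

/-- The function `ι_X β`. -/
noncomputable def contract (X : VField m M) (β : OneForm m M) : M → ℝ := fun p => β p (X p)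

/-- The expression of a one-form in the preferred chart at `p`, that is, its pullback to the
model space under the inverse of the chart. -/
noncomputable def formInChart (β : OneForm m M) (p : M) (y : EuclideanSpace ℝ (Fin m)) :
    EuclideanSpace ℝ (Fin m) →L[ℝ] ℝ :=
  (β ((extChartAt (𝓡 m) p).symm y)).comp
    (mfderiv 𝓘(ℝ, EuclideanSpace ℝ (Fin m)) (𝓡 m) (extChartAt (𝓡 m) p).symm y)

/-- The exterior derivative of a one-form, computed at `p` in the preferred chart at `p`:
`dβ(v, w) = D_v β(w) - D_w β(v)`; here `dForm β p v` is the covector `ι_v dβ`. -/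
noncomputable def dForm (β : OneForm m M) (p : M) (v : Tan m M p) : Cot m M p :=
  let D : EuclideanSpace ℝ (Fin m) →L[ℝ] EuclideanSpace ℝ (Fin m) →L[ℝ] ℝ :=
    fderiv ℝ (formInChart β p) (extChartAt (𝓡 m) p p)
  let T : Tan m M p →L[ℝ] EuclideanSpace ℝ (Fin m) :=
    mfderiv (𝓡 m) 𝓘(ℝ, EuclideanSpace ℝ (Fin m)) (extChartAt (𝓡 m) p) p
  (D (T v) - D.flip (T v)).comp T

/-- The Lie derivative `L_X β = ι_X dβ + d(ι_X β)` of a one-form. -/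
noncomputable def lieForm (X : VField m M) (β : OneForm m M) : OneForm m M :=
  fun p => dForm β p (X p) + dFun (contract X β) p

/-- The symmetric pairing `⟨X + α, Y + β⟩ = ½ (β(X) + α(Y))` on a fibre of `TM ⊕ T*M`. -/
noncomputable def pairing {p : M} (u v : Gen m M p) : ℝ := (1 / 2) * (v.2 u.1 + u.2 v.1)

/-- The (skew-symmetric) Courant bracket
`[X, Y] + L_X β - L_Y α - ½ d(ι_X β - ι_Y α)` of `X + α` and `Y + β`. -/
noncomputable def courant (s t : GenSection m M) : GenSection m M :=
  let X : VField m M := fun p => (s p).1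
  let α : OneForm m M := fun p => (s p).2
  let Y : VField m M := fun p => (t p).1
  let β : OneForm m M := fun p => (t p).2
  fun p =>
    (VectorField.mlieBracket (𝓡 m) X Y p,
      lieForm X β p - lieForm Y α p - (1 / 2 : ℝ) • dFun (contract X β - contract Y α) p)

variable [IsManifold (𝓡 m) ∞ M]

/-- Smoothness of a vector field. -/
def SmoothV (X : VField m M) : Prop :=
  ContMDiff (𝓡 m) ((𝓡 m).prod 𝓘(ℝ, EuclideanSpace ℝ (Fin m))) ∞
    (fun p => Bundle.TotalSpace.mk' (EuclideanSpace ℝ (Fin m)) (E := Tan m M) p (X p))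

/-- Smoothness of a one-form. -/
def SmoothF (α : OneForm m M) : Prop :=
  ContMDiff (𝓡 m) ((𝓡 m).prod 𝓘(ℝ, EuclideanSpace ℝ (Fin m) →L[ℝ] ℝ)) ∞
    (fun p => Bundle.TotalSpace.mk' (EuclideanSpace ℝ (Fin m) →L[ℝ] ℝ) (E := Cot m M) p (α p))

/-- Smoothness of a section of `TM ⊕ T*M`. -/
def SmoothG (s : GenSection m M) : Prop :=
  SmoothV (fun p => (s p).1) ∧ SmoothF (fun p => (s p).2)

/-- Smoothness of a bundle endomorphism of `TM ⊕ T*M`, as a map of the total space. -/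
def SmoothEnd (Φ : ∀ p : M, Gen m M p →ₗ[ℝ] Gen m M p) : Prop :=
  ContMDiff
    ((𝓡 m).prod 𝓘(ℝ, EuclideanSpace ℝ (Fin m) × (EuclideanSpace ℝ (Fin m) →L[ℝ] ℝ)))
    ((𝓡 m).prod 𝓘(ℝ, EuclideanSpace ℝ (Fin m) × (EuclideanSpace ℝ (Fin m) →L[ℝ] ℝ))) ∞
    (fun v : Bundle.TotalSpace (EuclideanSpace ℝ (Fin m) × (EuclideanSpace ℝ (Fin m) →L[ℝ] ℝ))
        (Tan m M ×ᵇ Cot m M) =>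
      (⟨v.1, Φ v.1 v.2⟩ : Bundle.TotalSpace
        (EuclideanSpace ℝ (Fin m) × (EuclideanSpace ℝ (Fin m) →L[ℝ] ℝ)) (Tan m M ×ᵇ Cot m M)))

end Real

/-! ### The complexified bundle `(TM ⊕ T*M)_ℂ` -/

section Complex

variable (m : ℕ) (M : Type*) [TopologicalSpace M] [ChartedSpace (EuclideanSpace ℝ (Fin m)) M]

/-- Complex-valued functions on `M`. -/
abbrev CFun : Type _ := Complexification (M → ℝ)

/-- Complex vector fields. -/
abbrev CVField : Type _ := Complexification (VField m M)

/-- Sections of `(TM ⊕ T*M)_ℂ`. -/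
abbrev CSection : Type _ := Complexification (GenSection m M)

/-- Fibrewise families of complex subspaces of `(TM ⊕ T*M)_ℂ`. -/
abbrev CSub : Type _ := ∀ p : M, Submodule ℂ (Complexification (Gen m M p))

variable {m M}

/-- The value of a complex section at a point. -/
def evalAt (s : CSection m M) (p : M) : Complexification (Gen m M p) := ⟨s.re p, s.im p⟩

/-- The product of a complex function and a section. -/
noncomputable def fsmul (f : CFun M) (s : CSection m M) : CSection m M :=
  Complexification.bilin (fun g t p => g p • t p) f s

/-- The anchor map, that is, the projection to `TM_ℂ`. -/
noncomputable def anchor (s : CSection m M) : CVField m M :=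
  Complexification.map (fun t p => (t p).1) s

/-- The derivative of a complex function along a complex vector field. -/
noncomputable def cDeriv (X : CVField m M) (f : CFun M) : CFun M :=
  Complexification.bilin derivAlong X f

/-- The complex-bilinear Lie bracket of complex vector fields. -/
noncomputable def cLie (X Y : CVField m M) : CVField m M :=
  Complexification.bilin (fun X Y => VectorField.mlieBracket (𝓡 m) X Y) X Y

/-- The complex-bilinear symmetric pairing on a fibre of `(TM ⊕ T*M)_ℂ`, with values in
`ℝ ⊕ iℝ`. -/
noncomputable def cPairing {p : M} (x y : Complexification (Gen m M p)) : Complexification ℝ :=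
  Complexification.bilin pairing x y

/-- The complex-bilinear symmetric pairing of sections. -/
noncomputable def sPairing (s t : CSection m M) : CFun M :=
  Complexification.bilin (fun u v p => pairing (u p) (v p)) s t

/-- The complex-bilinear Courant bracket. -/
noncomputable def cCourant (s t : CSection m M) : CSection m M :=
  Complexification.bilin courant s t

/-- Smoothness of a complex function. -/
def SmoothC (f : CFun M) : Prop :=
  ContMDiff (𝓡 m) 𝓘(ℝ, ℝ) ∞ f.re ∧ ContMDiff (𝓡 m) 𝓘(ℝ, ℝ) ∞ f.im

variable [IsManifold (𝓡 m) ∞ M]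

/-- The space `Γ(A)` of smooth sections of a subbundle `A` of `(TM ⊕ T*M)_ℂ`. -/
def Sec (A : CSub m M) : Set (CSection m M) :=
  {s | SmoothG s.re ∧ SmoothG s.im ∧ ∀ p, evalAt s p ∈ A p}

/-- `Γ(A)` is closed under the Courant bracket. -/
def CourantClosed (A : CSub m M) : Prop :=
  ∀ s ∈ Sec A, ∀ t ∈ Sec A, cCourant s t ∈ Sec A

/-! ### Lie algebroids and Lie bialgebroids for the induced Courant bracket -/

/-- The subbundle `A`, with the Courant bracket restricted to `Γ(A)` and the projection to
`TM_ℂ` as anchor, is a complex Lie algebroid. -/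
structure IsLieAlgebroid (A : CSub m M) : Prop where
  closed : CourantClosed A
  skew : ∀ s ∈ Sec A, ∀ t ∈ Sec A, cCourant s t = -cCourant t s
  jacobi : ∀ s ∈ Sec A, ∀ t ∈ Sec A, ∀ u ∈ Sec A,
    cCourant (cCourant s t) u + cCourant (cCourant t u) s + cCourant (cCourant u s) t = 0
  leibniz : ∀ s ∈ Sec A, ∀ t ∈ Sec A, ∀ f : CFun M, SmoothC (m := m) f →
    cCourant s (fsmul f t) = fsmul f (cCourant s t) + fsmul (cDeriv (anchor s) f) t
  anchor_bracket : ∀ s ∈ Sec A, ∀ t ∈ Sec A,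
    anchor (cCourant s t) = cLie (anchor s) (anchor t)

/-- The pairing restricted to `A × B` is non-degenerate at every point, so that it identifies
each of `A`, `B` with the dual bundle of the other. -/
def InDuality (A B : CSub m M) : Prop :=
  ∀ p, (∀ x ∈ A p, (∀ y ∈ B p, cPairing x y = 0) → x = 0) ∧
    (∀ y ∈ B p, (∀ x ∈ A p, cPairing x y = 0) → y = 0)

/-- For a Lie algebroid `A` in duality with `B`, the Lie derivative `τ = L_a σ` of
`σ ∈ Γ(B) = Γ(A*)` along `a ∈ Γ(A)`: the section of `B` with
`⟨τ, a'⟩ = ρ(a)⟨σ, a'⟩ - ⟨σ, [a, a']⟩` for all `a' ∈ Γ(A)`. -/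
def IsLieDerivative (A B : CSub m M) (a σ τ : CSection m M) : Prop :=
  τ ∈ Sec B ∧ ∀ a' ∈ Sec A,
    sPairing τ a' = cDeriv (anchor a) (sPairing σ a') - sPairing σ (cCourant a a')

/-- The Lie algebroid differential `d_B a` of `a ∈ Γ(A) = Γ(B*)`, an element of
`Γ(∧² B*) = Γ(∧² A)`, evaluated on `σ, τ ∈ Γ(B)`:
`(d_B a)(σ, τ) = ρ(σ)⟨a, τ⟩ - ρ(τ)⟨a, σ⟩ - ⟨a, [σ, τ]⟩`. -/
noncomputable def dDual (a σ τ : CSection m M) : CFun M :=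
  cDeriv (anchor σ) (sPairing a τ) - cDeriv (anchor τ) (sPairing a σ)
    - sPairing a (cCourant σ τ)

/-- The Schouten bracket `[a, P] = L_a P` of `a ∈ Γ(A)` and `P ∈ Γ(∧² A)`, the latter viewed as
an alternating form on `Γ(B) = Γ(A*)`, evaluated on `σ, τ ∈ Γ(B)`; the argument `Lie` is the Lie
derivative `(a, σ) ↦ L_a σ` on `Γ(B)`. -/
noncomputable def schouten (Lie : CSection m M → CSection m M → CSection m M)
    (a : CSection m M) (P : CSection m M → CSection m M → CFun M) (σ τ : CSection m M) : CFun M :=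
  cDeriv (anchor a) (P σ τ) - P (Lie a σ) τ - P σ (Lie a τ)

/-- The pair `A`, `B` of subbundles of `(TM ⊕ T*M)_ℂ`, in duality through the pairing, is a Lie
bialgebroid with respect to the induced Courant bracket: both are Lie algebroids, and the
differential `d_B` is a derivation of the (Schouten) bracket of `A`,
`d_B [a₁, a₂] = [d_B a₁, a₂] + [a₁, d_B a₂]`, where `[P, a₂] = -[a₂, P]` for `P ∈ Γ(∧² A)`.
The Lie derivative `Lie` is determined on `Γ(A) × Γ(B)`, because `A` and `B` are in duality. -/
structure IsLieBialgebroid (A B : CSub m M) : Prop where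
  left : IsLieAlgebroid A
  right : IsLieAlgebroid B
  duality : InDuality A B
  compatible : ∃ Lie : CSection m M → CSection m M → CSection m M,
    (∀ a ∈ Sec A, ∀ σ ∈ Sec B, IsLieDerivative A B a σ (Lie a σ)) ∧
    ∀ a₁ ∈ Sec A, ∀ a₂ ∈ Sec A, ∀ σ ∈ Sec B, ∀ τ ∈ Sec B,
      dDual (cCourant a₁ a₂) σ τ
        = -schouten Lie a₂ (dDual a₁) σ τ + schouten Lie a₁ (dDual a₂) σ τ

/-! ### Generalized almost contact structures -/

variable (m M) in
/-- A generalized almost contact pair `(Φ, F + η)`. -/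
structure GenAlmostContactPair where
  Φ : ∀ p : M, Gen m M p →ₗ[ℝ] Gen m M p
  F : VField m M
  η : OneForm m M
  smooth_Φ : SmoothEnd Φ
  smooth_F : SmoothV F
  smooth_η : SmoothF η
  /-- `Φ + Φ* = 0`, the adjoint being taken with respect to the pairing. -/
  skew : ∀ (p : M) (u v : Gen m M p), pairing (Φ p u) v + pairing u (Φ p v) = 0
  η_F : ∀ p, η p (F p) = 1
  Φ_F : ∀ p, Φ p (F p, 0) = 0
  Φ_η : ∀ p, Φ p (0, η p) = 0
  /-- `Φ² = -1 + F ⊙ η`. -/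
  Φ_sq : ∀ (p : M) (u : Gen m M p), Φ p (Φ p u) = -u + (η p u.1 • F p, u.2 (F p) • η p)

namespace GenAlmostContactPair

variable (J : GenAlmostContactPair m M)

/-- The fibres of `ker η ⊕ ker F`. -/
def kerSum (p : M) : Submodule ℝ (Gen m M p) where
  carrier := {e | J.η p e.1 = 0 ∧ e.2 (J.F p) = 0}
  add_mem' := by
    rintro a b ⟨h1, h2⟩ ⟨h3, h4⟩
    simp [h1, h2, h3, h4]
  zero_mem' := by simp
  smul_mem' := by
    rintro c a ⟨h1, h2⟩
    simp [h1, h2]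

theorem Φ_mem_kerSum {p : M} (e : Gen m M p) : J.Φ p e ∈ J.kerSum p := by
  have h1 := J.skew p e (0, J.η p)
  have h2 := J.skew p e (J.F p, 0)
  rw [J.Φ_η] at h1
  rw [J.Φ_F] at h2
  constructor
  · simpa [pairing] using h1
  · simpa [pairing] using h2

theorem Φ_Φ {p : M} {e : Gen m M p} (he : e ∈ J.kerSum p) : J.Φ p (J.Φ p e) = -e := by
  rw [J.Φ_sq, he.1, he.2]
  ext <;> simp

/-- `{e + i ε Φ(e) | e ∈ ker η ⊕ ker F}` for a sign `ε = ±1`. -/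
noncomputable def eigen (ε : ℝ) (hε : ε * ε = 1) : CSub m M := fun p =>
  { carrier := {x | ∃ e ∈ J.kerSum p, x = ⟨e, ε • J.Φ p e⟩}
    add_mem' := by
      rintro _ _ ⟨a, ha, rfl⟩ ⟨b, hb, rfl⟩
      refine ⟨a + b, add_mem ha hb, ?_⟩
      apply Complexification.ext
      · rfl
      · simp
    zero_mem' := ⟨0, zero_mem _, by apply Complexification.ext <;> simp⟩
    smul_mem' := by
      rintro z _ ⟨a, ha, rfl⟩
      refine ⟨z.re • a - z.im • ε • J.Φ p a, ?_, ?_⟩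
      · exact sub_mem (Submodule.smul_mem _ _ ha)
          (Submodule.smul_mem _ _ (Submodule.smul_mem _ _ (J.Φ_mem_kerSum a)))
      · apply Complexification.ext
        · rfl
        · simp only [Complexification.smul_im, map_sub, map_smul, J.Φ_Φ ha]
          have h : z.im • a = (z.im * (ε * ε)) • a := by rw [hε, mul_one]
          rw [h]
          module }

/-- `E^{(1,0)} = {e - i Φ(e) | e ∈ ker η ⊕ ker F}`. -/
noncomputable def E10 : CSub m M := J.eigen (-1) (by norm_num)

/-- `E^{(0,1)} = {e + i Φ(e) | e ∈ ker η ⊕ ker F}`. -/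
noncomputable def E01 : CSub m M := J.eigen 1 (by norm_num)

/-- The complex line bundle `L_F` spanned by `F`. -/
noncomputable def LF : CSub m M := fun p => Submodule.span ℂ {⟨(J.F p, 0), 0⟩}

/-- The complex line bundle `L_η` spanned by `η`. -/
noncomputable def Lη : CSub m M := fun p => Submodule.span ℂ {⟨(0, J.η p), 0⟩}

/-- `L = L_F ⊕ E^{(1,0)}`. -/
noncomputable def L : CSub m M := fun p => J.LF p ⊔ J.E10 p

/-- `L* = L_η ⊕ E^{(0,1)}`. -/
noncomputable def Lstar : CSub m M := fun p => J.Lη p ⊔ J.E01 p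

/-- The pair represents a strong generalized contact structure: both `Γ(L)` and `Γ(L*)` are
closed under the Courant bracket. -/
def IsStrong : Prop := CourantClosed J.L ∧ CourantClosed J.Lstar

end GenAlmostContactPair

end Complex
end GenContact

/-!
Besides the Courant bracket, consider the Dorfman bracket `u ∘ v`, which differs from it by the
exact term `d⟨u, v⟩`. It satisfies the Leibniz form of the Jacobi identity (`cDorfman_cDorfman`) and
preserves the pairing (`cDeriv_sPairing`). Write `A = E^{(1,0)}` and `B = E^{(0,1)}`. They are the
eigenbundles of `Φ` for the eigenvalues `i` and `-i`; both are isotropic, so on their sections the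
two brackets agree, they are in duality, and the orthogonal complement of `A ⊕ B` is spanned by `F`
and `η`.

*Closedness.* A bracket of two sections of `A` lies in `L = L_F ⊕ A`, and its conjugate is a bracket
of sections of `B`, which lies in `L* = L_η ⊕ B`. So it is orthogonal to `η`, has no component along
`F`, and lies in `A` (`IsStrong.closed_E10`). The same argument applies to `B`, and both are Lie
algebroids (`IsIsotropic.isLieAlgebroid`).

*The defect.* In terms of the Dorfman bracket `(d_B a)(σ, τ) = -⟨a ∘ σ, τ⟩`, and the Lie derivative
`L_a σ` is the component of `a ∘ σ` in `B`. The Leibniz identity for `a₁`, `a₂`, `σ` then shows that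
the failure of `d_B` to be a derivation is `S(a₂ ∘ σ, a₁ ∘ τ) - S(a₁ ∘ σ, a₂ ∘ τ)`, where
`S(u, v) = 2 (⟨u, F⟩⟨v, η⟩ + ⟨u, η⟩⟨v, F⟩)` is the part of the pairing that comes from the span
of `F` and `η` (`defect_eq`, `cval_defect`).

*The condition on `dη`.* For sections `s`, `t` whose vector parts lie in `ker η`,
`⟨s ∘ t, η⟩ = ½ η([s, t]) = -½ dη(s, t)` (`cp_cDorfman_ηC`). If `dη` vanishes on `ker η`, every term
of the defect has a factor zero. Conversely, suppose that the defect vanishes, and replace `a₁` by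
`h a₁` for a function `h` with `h(p) = 0` and `dh_p(F) = 1`. At `p`, the bracket `(h a₁) ∘ σ` is
then `2⟨a₁, σ⟩ dh` up to a multiple of `a₁`, and the defect becomes the pointwise identity
`dη(a₂, σ)⟨a₁, τ⟩ = ⟨a₁, σ⟩ dη(a₂, τ)` (`dηC_mul_cp_of_isLieBialgebroid`). If `ker η` contained
vectors `v`, `w` with `dη(v, w) ≠ 0`, the real dimension of `ker η ⊕ ker F`, hence of `A`, would be
at least three; for given `σ` there would be `a₁ ≠ 0` in `A` orthogonal to `σ`, and by duality `τ`
with `⟨a₁, τ⟩ ≠ 0`, so that `dη` would vanish on `A × B`. By closedness `dη` also vanishes on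
`A × A` and `B × B`, and `v`, `w` are sums of elements of `A` and `B`, so `dη(v, w) = 0` after all.
-/

open scoped Topology

/-! ### Vector fields and one-forms in a chart, and the invariant formula for `dβ` -/

namespace GenContact

section

variable {m : ℕ} {M : Type*} [TopologicalSpace M] [ChartedSpace (EuclideanSpace ℝ (Fin m)) M]

/-- The representative of a vector field in the preferred chart at `p`. -/
noncomputable def fieldInChart (X : VField m M) (p : M) :
    EuclideanSpace ℝ (Fin m) → EuclideanSpace ℝ (Fin m) :=
  VectorField.mpullbackWithin 𝓘(ℝ, EuclideanSpace ℝ (Fin m)) (𝓡 m) (extChartAt (𝓡 m) p).symm X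
    (Set.range (𝓡 m))

variable [IsManifold (𝓡 m) ∞ M]

/-- The fibre of the tangent bundle at `p` is the model space, identified through the preferred
chart at `p`; hence the derivative at `p` of that chart, and of its inverse, is the identity. -/
theorem mfderiv_extChartAt_symm_self (p : M) :
    mfderiv 𝓘(ℝ, EuclideanSpace ℝ (Fin m)) (𝓡 m) (extChartAt (𝓡 m) p).symm (extChartAt (𝓡 m) p p)
      = ContinuousLinearMap.id ℝ _ := by
  have := mfderivWithin_range_extChartAt_symm (I := 𝓡 m) (x := p)
  rwa [ModelWithCorners.range_eq_univ, mfderivWithin_univ] at this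

theorem formInChart_self (β : OneForm m M) (p : M) :
    formInChart β p (extChartAt (𝓡 m) p p) = β p := by
  unfold formInChart
  rw [mfderiv_extChartAt_symm_self, extChartAt_to_inv]
  rfl

theorem fieldInChart_self (X : VField m M) (p : M) :
    fieldInChart X p (extChartAt (𝓡 m) p p) = X p := by
  unfold fieldInChart
  rw [VectorField.mpullbackWithin_apply, extChartAt_to_inv]
  exact mfderivWithin_extChartAt_symm_inverse_apply (X p)

theorem formInChart_fieldInChart (X : VField m M) (β : OneForm m M) (p : M)
    {y : EuclideanSpace ℝ (Fin m)} (hy : y ∈ (extChartAt (𝓡 m) p).target) :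
    formInChart β p y (fieldInChart X p y) = contract X β ((extChartAt (𝓡 m) p).symm y) := by
  have h := isInvertible_mfderivWithin_extChartAt_symm hy
  unfold formInChart fieldInChart contract
  rw [VectorField.mpullbackWithin_apply]
  rw [ModelWithCorners.range_eq_univ, mfderivWithin_univ] at h ⊢
  obtain ⟨e, he⟩ := h
  rw [← he, ContinuousLinearMap.inverse_equiv]
  exact congrArg (β _) (e.apply_symm_apply _)

theorem SmoothV.differentiableAt_fieldInChart {X : VField m M} (hX : SmoothV X) (p : M) :
    DifferentiableAt ℝ (fieldInChart X p) (extChartAt (𝓡 m) p p) := by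
  have h : MDifferentiableWithinAt (𝓡 m) ((𝓡 m).prod 𝓘(ℝ, EuclideanSpace ℝ (Fin m)))
      (fun x => (X x : TangentBundle (𝓡 m) M)) Set.univ p :=
    ((hX p).mdifferentiableAt (by simp)).mdifferentiableWithinAt
  have h2 := h.differentiableWithinAt_mpullbackWithin_vectorField
  rw [Set.preimage_univ, ModelWithCorners.range_eq_univ, Set.univ_inter] at h2
  refine differentiableWithinAt_univ.1 ?_
  unfold fieldInChart
  rw [ModelWithCorners.range_eq_univ]
  exact h2

/-- The expression of a covector in the preferred trivialization of `T*M` at `p`. -/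
theorem inCoordinates_cot (p x : M) (α : Cot m M x) :
    ContinuousLinearMap.inCoordinates (EuclideanSpace ℝ (Fin m)) (Tan m M) ℝ
      (Bundle.Trivial M ℝ) p x p x α =
    α.comp ((trivializationAt (EuclideanSpace ℝ (Fin m)) (Tan m M) p).symmL ℝ x) := by
  ext v
  exact DFunLike.congr_fun (Bundle.Trivial.continuousLinearMapAt_trivialization ℝ M ℝ x) _

theorem SmoothF.contDiffAt_formInChart {β : OneForm m M} (hβ : SmoothF β) (p : M) :
    ContDiffAt ℝ ∞ (formInChart β p) (extChartAt (𝓡 m) p p) := by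
  have h := ((contMDiffAt_hom_bundle _).1 (hβ p)).2
  have h0 : ContMDiffAt 𝓘(ℝ, EuclideanSpace ℝ (Fin m)) (𝓡 m) ∞ (extChartAt (𝓡 m) p).symm
      (extChartAt (𝓡 m) p p) :=
    (contMDiffOn_extChartAt_symm p).contMDiffAt (extChartAt_target_mem_nhds p)
  have h1 := h.comp_of_eq h0 (extChartAt_to_inv p)
  refine (contMDiffAt_iff_contDiffAt.1 h1).congr_of_eventuallyEq ?_
  filter_upwards [extChartAt_target_mem_nhds (I := 𝓡 m) p] with y hy
  have hy' : (extChartAt (𝓡 m) p).symm y ∈ (chartAt (EuclideanSpace ℝ (Fin m)) p).source := by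
    rw [← extChartAt_source (𝓡 m)]; exact (extChartAt (𝓡 m) p).map_target hy
  have e1 := TangentBundle.symmL_trivializationAt (𝕜 := ℝ) (I := 𝓡 m) hy'
  rw [(extChartAt (𝓡 m) p).right_inv hy, ModelWithCorners.range_eq_univ, mfderivWithin_univ] at e1
  unfold formInChart
  rw [← e1]
  exact (inCoordinates_cot p _ _).symm

omit [IsManifold (𝓡 m) ∞ M] in
theorem derivAlong_eq_fderiv (X : VField m M) {f : M → ℝ} {p : M}
    (hf : MDifferentiableAt (𝓡 m) 𝓘(ℝ, ℝ) f p) :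
    derivAlong X f p =
      fderiv ℝ (f ∘ (extChartAt (𝓡 m) p).symm) (extChartAt (𝓡 m) p p) (X p) := by
  have h : mfderiv (𝓡 m) 𝓘(ℝ, ℝ) f p =
      fderivWithin ℝ (writtenInExtChartAt (𝓡 m) 𝓘(ℝ, ℝ) p f) (Set.range (𝓡 m))
        (extChartAt (𝓡 m) p p) := by
    unfold mfderiv
    exact if_pos hf
  unfold derivAlong dFun
  rw [h, ModelWithCorners.range_eq_univ, fderivWithin_univ]
  rfl

theorem mlieBracket_eq_lieBracket (X Y : VField m M) (p : M) :
    VectorField.mlieBracket (𝓡 m) X Y p =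
      VectorField.lieBracket ℝ (fieldInChart X p) (fieldInChart Y p) (extChartAt (𝓡 m) p p) := by
  rw [← VectorField.mlieBracketWithin_univ, VectorField.mlieBracketWithin_apply,
    mfderiv_extChartAt_self, Set.preimage_univ, Set.univ_inter]
  refine (DFunLike.congr_fun
    (ContinuousLinearMap.inverse_id (R := ℝ) (M := TangentSpace (𝓡 m) p)) _).trans ?_
  unfold fieldInChart
  rw [ModelWithCorners.range_eq_univ]
  have h : ∀ A B : EuclideanSpace ℝ (Fin m) → EuclideanSpace ℝ (Fin m), ∀ y,
      VectorField.lieBracketWithin ℝ A B Set.univ y = VectorField.lieBracket ℝ A B y :=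
    fun A B y => congrFun VectorField.lieBracketWithin_univ y
  exact h _ _ _

/-- The product rule for `β(X)`, in the preferred chart at `p`. -/
theorem derivAlong_contract (W X : VField m M) {β : OneForm m M} (hX : SmoothV X)
    (hβ : SmoothF β) {p : M} (hf : MDifferentiableAt (𝓡 m) 𝓘(ℝ, ℝ) (contract X β) p) :
    derivAlong W (contract X β) p =
      fderiv ℝ (formInChart β p) (extChartAt (𝓡 m) p p) (W p) (X p) +
        β p (fderiv ℝ (fieldInChart X p) (extChartAt (𝓡 m) p p) (W p)) := by
  rw [derivAlong_eq_fderiv W hf]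
  have he : (contract X β ∘ (extChartAt (𝓡 m) p).symm) =ᶠ[𝓝 (extChartAt (𝓡 m) p p)]
      fun y => formInChart β p y (fieldInChart X p y) := by
    filter_upwards [extChartAt_target_mem_nhds (I := 𝓡 m) p] with y hy
    exact (formInChart_fieldInChart X β p hy).symm
  rw [he.fderiv_eq, fderiv_clm_apply
    ((hβ.contDiffAt_formInChart p).differentiableAt (by simp)) (hX.differentiableAt_fieldInChart p),
    fieldInChart_self, formInChart_self]
  exact add_comm _ _

theorem SmoothF.contract {X : VField m M} {β : OneForm m M} (hβ : SmoothF β) (hX : SmoothV X) :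
    ContMDiff (𝓡 m) 𝓘(ℝ, ℝ) ∞ (contract X β) := by
  intro p
  have h := ContMDiffAt.clm_bundle_apply (F₂ := ℝ) (E₂ := Bundle.Trivial M ℝ) (hβ p) (hX p)
  exact ((Bundle.contMDiffAt_section _).1 h)

/-- The invariant formula for the exterior derivative of a one-form:
`dβ(X, Y) = X β(Y) - Y β(X) - β([X, Y])`. -/
theorem dForm_apply {X Y : VField m M} {β : OneForm m M} (hX : SmoothV X) (hY : SmoothV Y)
    (hβ : SmoothF β) (p : M) :
    dForm β p (X p) (Y p) = derivAlong X (GenContact.contract Y β) p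
      - derivAlong Y (GenContact.contract X β) p - β p (VectorField.mlieBracket (𝓡 m) X Y p) := by
  rw [derivAlong_contract X Y hY hβ ((hβ.contract hY p).mdifferentiableAt (by simp)),
    derivAlong_contract Y X hX hβ ((hβ.contract hX p).mdifferentiableAt (by simp)),
    mlieBracket_eq_lieBracket, VectorField.lieBracket, fieldInChart_self, fieldInChart_self]
  have e : dForm β p (X p) (Y p) = fderiv ℝ (formInChart β p) (extChartAt (𝓡 m) p p) (X p) (Y p)
      - fderiv ℝ (formInChart β p) (extChartAt (𝓡 m) p p) (Y p) (X p) := by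
    unfold dForm
    rw [mfderiv_extChartAt_self]
    rfl
  have e2 := (β p).map_sub (fderiv ℝ (fieldInChart Y p) (extChartAt (𝓡 m) p p) (X p))
    (fderiv ℝ (fieldInChart X p) (extChartAt (𝓡 m) p p) (Y p))
  rw [e]
  refine Eq.trans ?_ (congrArg (fun t => _ - t) e2.symm)
  ring

end

end GenContact

/-! ### Extending pointwise data to global smooth sections -/

namespace GenContact

section

variable {m : ℕ} {M : Type*} [TopologicalSpace M] [T2Space M]
  [ChartedSpace (EuclideanSpace ℝ (Fin m)) M] [IsManifold (𝓡 m) ∞ M]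

/-- A section that is smooth near `p` agrees near `p` with a global smooth section. -/
theorem exists_contMDiff_section_eventuallyEq {G : Type*} [NormedAddCommGroup G] [NormedSpace ℝ G]
    {V : M → Type*} [TopologicalSpace (Bundle.TotalSpace G V)] [∀ x, AddCommGroup (V x)]
    [∀ x, Module ℝ (V x)] [∀ x : M, TopologicalSpace (V x)] [FiberBundle G V] [VectorBundle ℝ G V]
    [ContMDiffVectorBundle ∞ G V (𝓡 m)]
    {p : M} {s : ∀ x, V x} {u : Set M} (hu : u ∈ 𝓝 p)
    (hs : ContMDiffOn (𝓡 m) ((𝓡 m).prod 𝓘(ℝ, G)) ∞ (fun x => Bundle.TotalSpace.mk' G x (s x)) u) :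
    ∃ t : ∀ x, V x, ContMDiff (𝓡 m) ((𝓡 m).prod 𝓘(ℝ, G)) ∞
      (fun x => Bundle.TotalSpace.mk' G x (t x)) ∧ ∀ᶠ x in 𝓝 p, t x = s x := by
  obtain ⟨f, -, hf⟩ := (SmoothBumpFunction.nhds_basis_tsupport (I := 𝓡 m) p).mem_iff.1
    (interior_mem_nhds.2 hu)
  refine ⟨fun x => f x • s x, ?_, ?_⟩
  · exact ContMDiffOn.smul_section_of_tsupport f.contMDiff.contMDiffOn isOpen_interior hf
      (hs.mono interior_subset)
  · filter_upwards [f.eventuallyEq_one] with x hx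
    rw [hx]
    exact one_smul _ _

/-- A constant section in the preferred trivialization at `p` agrees near `p` with a global smooth
section. -/
theorem exists_contMDiff_section_frame {G : Type*} [NormedAddCommGroup G] [NormedSpace ℝ G]
    (V : M → Type*) [TopologicalSpace (Bundle.TotalSpace G V)] [∀ x, AddCommGroup (V x)]
    [∀ x, Module ℝ (V x)] [∀ x : M, TopologicalSpace (V x)] [FiberBundle G V] [VectorBundle ℝ G V]
    [ContMDiffVectorBundle ∞ G V (𝓡 m)] (p : M) (e : G) :
    ∃ t : ∀ x, V x, ContMDiff (𝓡 m) ((𝓡 m).prod 𝓘(ℝ, G)) ∞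
      (fun x => Bundle.TotalSpace.mk' G x (t x)) ∧
      ∀ᶠ x in 𝓝 p, t x = (trivializationAt G V p).symmL ℝ x e := by
  have hp := FiberBundle.mem_baseSet_trivializationAt' (F := G) (E := V) p
  obtain ⟨u, hu, hs⟩ := FiberBundle.exists_contMDiffOn_extend (k := ∞) (𝓡 m) G
    ((trivializationAt G V p).symmL ℝ p e)
  obtain ⟨t, ht, h⟩ := exists_contMDiff_section_eventuallyEq hu hs
  refine ⟨t, ht, ?_⟩
  filter_upwards [h, (trivializationAt G V p).open_baseSet.mem_nhds hp] with x hx hxb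
  rw [hx]
  unfold FiberBundle.extend
  rw [(trivializationAt G V p).symmL_apply (R := ℝ) hxb,
    (trivializationAt G V p).symmL_apply (R := ℝ) hp, (trivializationAt G V p).apply_mk_symm hp]

theorem exists_smoothV (p : M) (v : Tan m M p) : ∃ X : VField m M, SmoothV X ∧ X p = v := by
  obtain ⟨u, hu, hs⟩ := FiberBundle.exists_contMDiffOn_extend (k := ∞) (𝓡 m)
    (EuclideanSpace ℝ (Fin m)) (V := Tan m M) v
  obtain ⟨X, hX, h⟩ := exists_contMDiff_section_eventuallyEq hu hs
  exact ⟨X, hX, h.self_of_nhds.trans (by simp)⟩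

theorem exists_smoothF (p : M) (v : Cot m M p) : ∃ X : OneForm m M, SmoothF X ∧ X p = v := by
  obtain ⟨u, hu, hs⟩ := FiberBundle.exists_contMDiffOn_extend (k := ∞) (𝓡 m)
    (EuclideanSpace ℝ (Fin m) →L[ℝ] ℝ) (V := Cot m M) v
  obtain ⟨X, hX, h⟩ := exists_contMDiff_section_eventuallyEq hu hs
  exact ⟨X, hX, h.self_of_nhds.trans (by simp)⟩

omit [T2Space M] in
theorem clm_eq_sum (T : EuclideanSpace ℝ (Fin m) →L[ℝ] ℝ) :
    T = ∑ i : Fin m, T (EuclideanSpace.single i 1) • (EuclideanSpace.proj i :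
      EuclideanSpace ℝ (Fin m) →L[ℝ] ℝ) := by
  ext v
  have hv : v = ∑ i : Fin m, v i • EuclideanSpace.single i (1 : ℝ) := by
    ext j; simp [Pi.single_apply]
  conv_lhs => rw [hv]
  simp [mul_comm]

/-- A one-form is smooth as soon as all its contractions with smooth vector fields are. -/
theorem smoothF_of_contract {α : OneForm m M}
    (h : ∀ X : VField m M, SmoothV X → ContMDiff (𝓡 m) 𝓘(ℝ, ℝ) ∞ (contract X α)) : SmoothF α := by
  intro p
  refine (contMDiffAt_hom_bundle _).2 ⟨contMDiffAt_id, ?_⟩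
  have key : ∀ e : EuclideanSpace ℝ (Fin m), ContMDiffAt (𝓡 m) 𝓘(ℝ, ℝ) ∞
      (fun x =>
        (α x) ((trivializationAt (EuclideanSpace ℝ (Fin m)) (Tan m M) p).symmL ℝ x e)) p := by
    intro e
    obtain ⟨X, hX, he⟩ := exists_contMDiff_section_frame (m := m) (Tan m M) p e
    refine (h X hX p).congr_of_eventuallyEq ?_
    filter_upwards [he] with x hx
    rw [← hx]
    rfl
  have hsum : ContMDiffAt (𝓡 m) 𝓘(ℝ, EuclideanSpace ℝ (Fin m) →L[ℝ] ℝ) ∞ (fun x => ∑ i : Fin m,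
      (α x) ((trivializationAt (EuclideanSpace ℝ (Fin m)) (Tan m M) p).symmL ℝ x
        (EuclideanSpace.single i 1)) •
          (EuclideanSpace.proj i : EuclideanSpace ℝ (Fin m) →L[ℝ] ℝ)) p :=
    ContMDiffAt.sum fun i _ => (key _).smul contMDiffAt_const
  refine hsum.congr_of_eventuallyEq (Filter.Eventually.of_forall fun x => ?_)
  refine (inCoordinates_cot p x (α x)).trans ?_
  exact clm_eq_sum _

/-- A smooth function that vanishes at `p` and has a prescribed differential there: the linear
coordinate `α` of the preferred chart, cut off by a bump function. -/
theorem exists_smoothR_dFun_eq (p : M) (α : Cot m M p) :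
    ∃ h : M → ℝ, ContMDiff (𝓡 m) 𝓘(ℝ, ℝ) ∞ h ∧ h p = 0 ∧ dFun (m := m) h p = α := by
  obtain ⟨f, -, -⟩ := (SmoothBumpFunction.nhds_basis_tsupport (I := 𝓡 m) p).mem_iff.1
    Filter.univ_mem
  let ℓ : EuclideanSpace ℝ (Fin m) →L[ℝ] ℝ := α
  let g : M → ℝ := fun x => ℓ (extChartAt (𝓡 m) p x) - ℓ (extChartAt (𝓡 m) p p)
  have hg : ContMDiffOn (𝓡 m) 𝓘(ℝ, ℝ) ∞ g (chartAt (EuclideanSpace ℝ (Fin m)) p).source :=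
    (ℓ.contMDiff.comp_contMDiffOn contMDiffOn_extChartAt).sub contMDiffOn_const
  refine ⟨fun x => f x • g x, f.contMDiff_smul hg, by simp [g], ?_⟩
  have he : (fun x => f x • g x) =ᶠ[𝓝 p] g := by
    filter_upwards [f.eventuallyEq_one] with x hx
    rw [hx]
    exact one_smul _ _
  unfold dFun
  rw [he.mfderiv_eq]
  have h1 : HasMFDerivAt (𝓡 m) 𝓘(ℝ, EuclideanSpace ℝ (Fin m)) (extChartAt (𝓡 m) p) p
      (ContinuousLinearMap.id ℝ _) := by
    have := (mdifferentiableAt_extChartAt (I := 𝓡 m) (mem_chart_source _ p)).hasMFDerivAt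
    rwa [mfderiv_extChartAt_self] at this
  have h2 := ((ℓ.hasMFDerivAt (x := extChartAt (𝓡 m) p p)).comp p h1).sub
    (hasMFDerivAt_const (I := 𝓡 m) (ℓ (extChartAt (𝓡 m) p p)) p)
  refine h2.mfderiv.trans ?_
  ext v
  exact sub_zero _

end

end GenContact

/-! ### Cartan calculus for vector fields, functions and one-forms -/

namespace GenContact

section

variable {m : ℕ} {M : Type*} [TopologicalSpace M] [ChartedSpace (EuclideanSpace ℝ (Fin m)) M]

variable (m) in
/-- Smoothness of a real function. -/
abbrev SmoothR (f : M → ℝ) : Prop := ContMDiff (𝓡 m) 𝓘(ℝ, ℝ) ∞ f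

theorem SmoothR.mdifferentiableAt {f : M → ℝ} (hf : SmoothR m f) (p : M) :
    MDifferentiableAt (𝓡 m) 𝓘(ℝ, ℝ) f p := (hf p).mdifferentiableAt (by simp)

theorem dFun_add {f g : M → ℝ} (hf : SmoothR m f) (hg : SmoothR m g) (p : M) :
    dFun (m := m) (f + g) p = dFun f p + dFun g p :=
  mfderiv_add (hf.mdifferentiableAt p) (hg.mdifferentiableAt p)

theorem dFun_sub {f g : M → ℝ} (hf : SmoothR m f) (hg : SmoothR m g) (p : M) :
    dFun (m := m) (f - g) p = dFun f p - dFun g p :=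
  mfderiv_sub (hf.mdifferentiableAt p) (hg.mdifferentiableAt p)

theorem dFun_const_smul {f : M → ℝ} (hf : SmoothR m f) (c : ℝ) (p : M) :
    dFun (m := m) (c • f) p = c • dFun f p :=
  const_smul_mfderiv (hf.mdifferentiableAt p) c

theorem dFun_mul {f g : M → ℝ} (hf : SmoothR m f) (hg : SmoothR m g) (p : M) :
    dFun (m := m) (f * g) p = f p • dFun g p + g p • dFun f p :=
  (((hf.mdifferentiableAt p).hasMFDerivAt).mul ((hg.mdifferentiableAt p).hasMFDerivAt)).mfderiv

variable [IsManifold (𝓡 m) ∞ M]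

theorem SmoothR.derivAlong {X : VField m M} {f : M → ℝ} (hf : SmoothR m f) (hX : SmoothV X) :
    SmoothR m (derivAlong X f) := by
  have h := (hf.contMDiff_tangentMap (m := ∞) (by simp)).comp hX
  exact (contMDiff_snd_tangentBundle_modelSpace ℝ 𝓘(ℝ, ℝ)).comp h

theorem SmoothV.mlieBracket {X Y : VField m M} (hX : SmoothV X) (hY : SmoothV Y) :
    SmoothV (VectorField.mlieBracket (𝓡 m) X Y) := fun p =>
  have : IsManifold (𝓡 m) (minSmoothness ℝ 2) M := by
    rw [minSmoothness_of_isRCLikeNormedField]; infer_instance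
  have : IsManifold (𝓡 m) (((⊤ : ℕ∞) : WithTop ℕ∞) + 1) M :=
    inferInstanceAs (IsManifold (𝓡 m) ∞ M)
  ContMDiffAt.mlieBracket_vectorField (m := ⊤) (n := ⊤) (hX p) (hY p) (by simp)

/-- Exact one-forms are closed: in a chart this is the symmetry of the second derivative. -/
theorem dForm_dFun {f : M → ℝ} (hf : SmoothR m f) (p : M) (v w : Tan m M p) :
    dForm (dFun (m := m) f) p v w = 0 := by
  have h0 : ContMDiffOn 𝓘(ℝ, EuclideanSpace ℝ (Fin m)) (𝓡 m) ∞ (extChartAt (𝓡 m) p).symm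
      (extChartAt (𝓡 m) p).target := contMDiffOn_extChartAt_symm p
  have ht := extChartAt_target_mem_nhds (I := 𝓡 m) p
  have hd : ContDiffAt ℝ ∞ (f ∘ (extChartAt (𝓡 m) p).symm) (extChartAt (𝓡 m) p p) :=
    contMDiffAt_iff_contDiffAt.1 ((hf _).comp _ (h0.contMDiffAt ht))
  have he : formInChart (dFun (m := m) f) p =ᶠ[𝓝 (extChartAt (𝓡 m) p p)]
      fderiv ℝ (f ∘ (extChartAt (𝓡 m) p).symm) := by
    filter_upwards [extChartAt_target_mem_nhds' (I := 𝓡 m) (mem_of_mem_nhds ht)] with y hy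
    have hy' := h0.contMDiffAt ((isOpen_extChartAt_target p).mem_nhds hy)
    rw [← mfderiv_eq_fderiv]
    exact (mfderiv_comp y (hf.mdifferentiableAt _) (hy'.mdifferentiableAt (by simp))).symm
  have hs := hd.isSymmSndFDerivAt (by
    rw [minSmoothness_of_isRCLikeNormedField]; exact WithTop.coe_le_coe.2 (le_top : (2 : ℕ∞) ≤ ⊤))
  unfold dForm
  rw [he.fderiv_eq, mfderiv_extChartAt_self]
  exact sub_eq_zero.2 (hs.eq v w)

theorem contract_dForm {X : VField m M} {α : OneForm m M} (hX : SmoothV X) (hα : SmoothF α)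
    {W : VField m M} (hW : SmoothV W) :
    contract W (fun p => dForm α p (X p)) = derivAlong X (contract W α)
      - derivAlong W (contract X α) - contract (VectorField.mlieBracket (𝓡 m) X W) α :=
  funext fun p => dForm_apply hX hW hα p

theorem contract_lieForm {X : VField m M} {α : OneForm m M} (hX : SmoothV X) (hα : SmoothF α)
    {W : VField m M} (hW : SmoothV W) :
    contract W (lieForm X α) = derivAlong X (contract W α)
      - contract (VectorField.mlieBracket (𝓡 m) X W) α := by
  funext p
  have h : contract W (lieForm X α) p = dForm α p (X p) (W p) + derivAlong W (contract X α) p := rfl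
  rw [h, dForm_apply hX hW hα]
  simp only [Pi.sub_apply]
  have : α p (VectorField.mlieBracket (𝓡 m) X W p)
    = contract (VectorField.mlieBracket (𝓡 m) X W) α p := rfl
  linarith

variable [T2Space M]

theorem SmoothR.dFun {f : M → ℝ} (hf : SmoothR m f) : SmoothF (dFun (m := m) f) :=
  smoothF_of_contract fun _ hX => SmoothR.derivAlong hf hX

/-- The bracket of vector fields acts on functions as the commutator of derivations, by the formula
for the exterior derivative of the closed form `df`. -/
theorem derivAlong_mlieBracket {X Y : VField m M} {f : M → ℝ} (hX : SmoothV X) (hY : SmoothV Y)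
    (hf : SmoothR m f) (p : M) :
    GenContact.derivAlong (VectorField.mlieBracket (𝓡 m) X Y) f p =
      GenContact.derivAlong X (GenContact.derivAlong Y f) p
        - GenContact.derivAlong Y (GenContact.derivAlong X f) p := by
  have h := dForm_apply hX hY (SmoothR.dFun hf) p
  rw [dForm_dFun hf] at h
  have e : ∀ Z : VField m M, GenContact.contract Z (GenContact.dFun f) =
    GenContact.derivAlong Z f := fun Z => rfl
  rw [e, e] at h
  have e2 : GenContact.dFun (m := m) f p (VectorField.mlieBracket (𝓡 m) X Y p) =
    GenContact.derivAlong (VectorField.mlieBracket (𝓡 m) X Y) f p := rfl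
  linarith

theorem SmoothF.dForm {α : OneForm m M} (hα : SmoothF α) {X : VField m M} (hX : SmoothV X) :
    SmoothF (fun p => dForm α p (X p)) := smoothF_of_contract fun W hW => by
  rw [contract_dForm hX hα hW]
  exact ((SmoothR.derivAlong (hα.contract hW) hX).sub (SmoothR.derivAlong (hα.contract hX) hW)).sub
    (hα.contract (hX.mlieBracket hW))

theorem SmoothF.lieForm {α : OneForm m M} (hα : SmoothF α) {X : VField m M} (hX : SmoothV X) :
    SmoothF (lieForm X α) := smoothF_of_contract fun W hW => by
  rw [contract_lieForm hX hα hW]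
  exact (SmoothR.derivAlong (hα.contract hW) hX).sub (hα.contract (hX.mlieBracket hW))

/-- A one-form is determined by its contractions with smooth vector fields. -/
theorem oneForm_ext {α β : OneForm m M}
    (h : ∀ X : VField m M, SmoothV X → contract X α = contract X β) : α = β := by
  funext p
  ext v
  obtain ⟨X, hX, rfl⟩ := exists_smoothV p v
  exact congrFun (h X hX) p

end

end GenContact

/-! ### The real Dorfman bracket -/

namespace GenContact

section

variable {m : ℕ} {M : Type*} [TopologicalSpace M] [ChartedSpace (EuclideanSpace ℝ (Fin m)) M]

/-- The vector field part of a section of `TM ⊕ T*M`. -/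
abbrev vec (s : GenSection m M) : VField m M := fun p => (s p).1

/-- The one-form part of a section of `TM ⊕ T*M`. -/
abbrev frm (s : GenSection m M) : OneForm m M := fun p => (s p).2

/-- The pairing of two sections, as a function. -/
noncomputable def pairF (s t : GenSection m M) : M → ℝ := fun p => pairing (s p) (t p)

/-- The Dorfman bracket `(X + α) ∘ (Y + β) = [X, Y] + L_X β - ι_Y dα`, whose skew-symmetrization is
the Courant bracket. -/
noncomputable def dorfman (s t : GenSection m M) : GenSection m M := fun p =>
  (VectorField.mlieBracket (𝓡 m) (vec s) (vec t) p,
    lieForm (vec s) (frm t) p - dForm (frm s) p (vec t p))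

/-- The section `df` of `T*M ⊆ TM ⊕ T*M`. -/
noncomputable def dGen (f : M → ℝ) : GenSection m M := fun p => (0, dFun f p)

theorem pairF_eq (s t : GenSection m M) :
    pairF s t = (1 / 2 : ℝ) • (contract (vec s) (frm t) + contract (vec t) (frm s)) := rfl

theorem dForm_antisymm (α : OneForm m M) (p : M) (v w : Tan m M p) :
    dForm α p v w = - dForm α p w v := by
  unfold dForm
  exact (neg_sub _ _).symm

theorem SmoothR.add {f g : M → ℝ} (hf : SmoothR m f) (hg : SmoothR m g) : SmoothR m (f + g) :=
  ContMDiff.add hf hg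

theorem SmoothR.sub {f g : M → ℝ} (hf : SmoothR m f) (hg : SmoothR m g) : SmoothR m (f - g) :=
  ContMDiff.sub hf hg

theorem SmoothR.const_smul {f : M → ℝ} (c : ℝ) (hf : SmoothR m f) : SmoothR m (c • f) :=
  ContMDiff.smul (contMDiff_const (I := 𝓡 m) (I' := 𝓘(ℝ, ℝ)) (c := c)) hf

theorem derivAlong_add (X : VField m M) {f g : M → ℝ} (hf : SmoothR m f) (hg : SmoothR m g) :
    derivAlong X (f + g) = derivAlong X f + derivAlong X g :=
  funext fun p => DFunLike.congr_fun (dFun_add hf hg p) (X p)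

theorem derivAlong_sub (X : VField m M) {f g : M → ℝ} (hf : SmoothR m f) (hg : SmoothR m g) :
    derivAlong X (f - g) = derivAlong X f - derivAlong X g :=
  funext fun p => DFunLike.congr_fun (dFun_sub hf hg p) (X p)

theorem derivAlong_const_smul (X : VField m M) {f : M → ℝ} (c : ℝ) (hf : SmoothR m f) :
    derivAlong X (c • f) = c • derivAlong X f :=
  funext fun p => DFunLike.congr_fun (dFun_const_smul hf c p) (X p)

theorem derivAlong_mul (X : VField m M) {f g : M → ℝ} (hf : SmoothR m f) (hg : SmoothR m g) :
    derivAlong X (f * g) = f * derivAlong X g + g * derivAlong X f :=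
  funext fun p => DFunLike.congr_fun (dFun_mul hf hg p) (X p)

theorem dGen_add {f g : M → ℝ} (hf : SmoothR m f) (hg : SmoothR m g) :
    dGen (m := m) (f + g) = dGen f + dGen g :=
  funext fun p => Prod.ext (add_zero _).symm (dFun_add hf hg p)

theorem dGen_sub {f g : M → ℝ} (hf : SmoothR m f) (hg : SmoothR m g) :
    dGen (m := m) (f - g) = dGen f - dGen g :=
  funext fun p => Prod.ext (sub_zero _).symm (dFun_sub hf hg p)

theorem pairF_comm (s t : GenSection m M) : pairF s t = pairF t s := by
  rw [pairF_eq, pairF_eq, add_comm]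

theorem pairF_add_left (s t u : GenSection m M) : pairF (s + t) u = pairF s u + pairF t u := by
  have e : contract (vec (s + t)) (frm u) = contract (vec s) (frm u) + contract (vec t) (frm u) :=
    funext fun p => (frm u p).map_add _ _
  have e2 : contract (vec u) (frm (s + t)) = contract (vec u) (frm s) + contract (vec u) (frm t) :=
    rfl
  rw [pairF_eq, pairF_eq, pairF_eq, e, e2]
  module

theorem pairF_neg_left (s t : GenSection m M) : pairF (-s) t = -pairF s t := by
  have e : contract (vec (-s)) (frm t) = -contract (vec s) (frm t) :=
    funext fun p => (frm t p).map_neg _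
  have e2 : contract (vec t) (frm (-s)) = -contract (vec t) (frm s) := rfl
  rw [pairF_eq, pairF_eq, e, e2]
  module

variable [IsManifold (𝓡 m) ∞ M]

theorem SmoothG.pairF {s t : GenSection m M} (hs : SmoothG s) (ht : SmoothG t) :
    SmoothR m (pairF s t) := by
  rw [pairF_eq]
  exact SmoothR.const_smul _ (SmoothR.add (ht.2.contract hs.1) (hs.2.contract ht.1))

theorem SmoothG.add {s t : GenSection m M} (hs : SmoothG s) (ht : SmoothG t) : SmoothG (s + t) :=
  ⟨ContMDiff.add_section hs.1 ht.1, ContMDiff.add_section (V := Cot m M) hs.2 ht.2⟩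

theorem SmoothG.sub {s t : GenSection m M} (hs : SmoothG s) (ht : SmoothG t) : SmoothG (s - t) :=
  ⟨ContMDiff.sub_section hs.1 ht.1, ContMDiff.sub_section (V := Cot m M) hs.2 ht.2⟩

theorem SmoothG.neg {s : GenSection m M} (hs : SmoothG s) : SmoothG (-s) :=
  ⟨ContMDiff.neg_section hs.1, ContMDiff.neg_section (V := Cot m M) hs.2⟩

theorem SmoothG.smul {f : M → ℝ} {s : GenSection m M} (hf : SmoothR m f) (hs : SmoothG s) :
    SmoothG (fun p => f p • s p) :=
  ⟨ContMDiff.smul_section hf hs.1, ContMDiff.smul_section (V := Cot m M) hf hs.2⟩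

theorem derivAlong_pairF (X : VField m M) {s t : GenSection m M} (hs : SmoothG s) (ht : SmoothG t) :
    derivAlong X (pairF s t) = (1 / 2 : ℝ) • (derivAlong X (contract (vec s) (frm t)) +
      derivAlong X (contract (vec t) (frm s))) := by
  rw [pairF_eq, derivAlong_const_smul _ _ ((ht.2.contract hs.1).add (hs.2.contract ht.1)),
    derivAlong_add _ (ht.2.contract hs.1) (hs.2.contract ht.1)]

/-- The one-form part of the Dorfman bracket on a test field `W`, in terms of brackets of vector
fields and derivatives of functions. -/
theorem contract_frm_dorfman {s t : GenSection m M} (hs : SmoothG s) (ht : SmoothG t)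
    {W : VField m M} (hW : SmoothV W) :
    contract W (frm (dorfman s t)) =
      derivAlong (vec s) (contract W (frm t))
        - contract (VectorField.mlieBracket (𝓡 m) (vec s) W) (frm t)
        - derivAlong (vec t) (contract W (frm s)) + derivAlong W (contract (vec t) (frm s))
        + contract (VectorField.mlieBracket (𝓡 m) (vec t) W) (frm s) := by
  have e : contract W (frm (dorfman s t)) = contract W (lieForm (vec s) (frm t))
    - contract W (fun p => dForm (frm s) p (vec t p)) := rfl
  rw [e, contract_lieForm hs.1 ht.2 hW, contract_dForm ht.1 hs.2 hW]
  abel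

theorem derivAlong_contract_frm_dorfman {s t : GenSection m M} (hs : SmoothG s) (ht : SmoothG t)
    {V W : VField m M} (hW : SmoothV W) :
    derivAlong V (contract W (frm (dorfman s t))) =
      derivAlong V (derivAlong (vec s) (contract W (frm t)))
        - derivAlong V (contract (VectorField.mlieBracket (𝓡 m) (vec s) W) (frm t))
        - derivAlong V (derivAlong (vec t) (contract W (frm s)))
        + derivAlong V (derivAlong W (contract (vec t) (frm s)))
        + derivAlong V (contract (VectorField.mlieBracket (𝓡 m) (vec t) W) (frm s)) := by
  have h1 := SmoothR.derivAlong (ht.2.contract hW) hs.1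
  have h2 := ht.2.contract (hs.1.mlieBracket hW)
  have h3 := SmoothR.derivAlong (hs.2.contract hW) ht.1
  have h4 := SmoothR.derivAlong (hs.2.contract ht.1) hW
  have h5 := hs.2.contract (ht.1.mlieBracket hW)
  rw [contract_frm_dorfman hs ht hW,
    derivAlong_add _ (SmoothR.add (SmoothR.sub (SmoothR.sub h1 h2) h3) h4) h5,
    derivAlong_add _ (SmoothR.sub (SmoothR.sub h1 h2) h3) h4,
    derivAlong_sub _ (SmoothR.sub h1 h2) h3, derivAlong_sub _ h1 h2]

/-- The pairing is invariant under the Dorfman bracket. -/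
theorem derivAlong_pairF_eq {s t u : GenSection m M} (hs : SmoothG s) (ht : SmoothG t)
    (hu : SmoothG u) :
    derivAlong (vec s) (pairF t u) = pairF (dorfman s t) u + pairF t (dorfman s u) := by
  have e : pairF (dorfman s t) u + pairF t (dorfman s u) = (1 / 2 : ℝ) •
      ((contract (VectorField.mlieBracket (𝓡 m) (vec s) (vec t)) (frm u) +
        contract (vec u) (frm (dorfman s t))) +
      (contract (vec t) (frm (dorfman s u)) +
        contract (VectorField.mlieBracket (𝓡 m) (vec s) (vec u)) (frm t))) := by
    rw [smul_add]; rfl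
  rw [e, derivAlong_pairF _ ht hu, contract_frm_dorfman hs ht hu.1, contract_frm_dorfman hs hu ht.1,
    VectorField.mlieBracket_swap (V := vec u) (W := vec t)]
  have e2 : contract (-VectorField.mlieBracket (𝓡 m) (vec t) (vec u)) (frm s) =
    - contract (VectorField.mlieBracket (𝓡 m) (vec t) (vec u)) (frm s) :=
    funext fun p => (frm s p).map_neg _
  rw [e2]
  congr 1
  abel

/-- The symmetric part of the Dorfman bracket is exact. -/
theorem dGen_pairF {s t : GenSection m M} (hs : SmoothG s) (ht : SmoothG t) :
    dGen (2 * pairF s t) = dorfman s t + dorfman t s := by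
  have h : 2 * pairF s t = contract (vec s) (frm t) + contract (vec t) (frm s) := by
    rw [pairF_eq]; ext p; simp; ring
  funext p
  refine Prod.ext ?_ ?_
  · have h2 := VectorField.mlieBracket_swap_apply (I := 𝓡 m) (V := vec s) (W := vec t) (x := p)
    exact (add_eq_zero_iff_eq_neg.2 h2).symm
  · change dFun _ p = _
    rw [h, dFun_add (ht.2.contract hs.1) (hs.2.contract ht.1)]
    change _ = (lieForm _ _ p - _) + (lieForm _ _ p - _)
    unfold lieForm
    abel

/-- The Courant bracket is the Dorfman bracket corrected by an exact term. -/
theorem courant_eq {s t : GenSection m M} (hs : SmoothG s) (ht : SmoothG t) :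
    courant s t = dorfman s t - dGen (pairF s t) := by
  funext p
  refine Prod.ext ?_ ?_
  · exact (sub_zero _).symm
  · have h1 := ht.2.contract hs.1
    have h2 := hs.2.contract ht.1
    change lieForm _ _ p - lieForm _ _ p - _ = lieForm _ _ p - _ - dFun _ p
    rw [pairF_eq, dFun_const_smul (SmoothR.add h1 h2), dFun_add h1 h2, dFun_sub h1 h2]
    unfold lieForm
    module

theorem mlieBracket_jacobi {X Y Z : VField m M} (hX : SmoothV X) (hY : SmoothV Y)
    (hZ : SmoothV Z) :
    VectorField.mlieBracket (𝓡 m) X (VectorField.mlieBracket (𝓡 m) Y Z) =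
      VectorField.mlieBracket (𝓡 m) (VectorField.mlieBracket (𝓡 m) X Y) Z +
        VectorField.mlieBracket (𝓡 m) Y (VectorField.mlieBracket (𝓡 m) X Z) := by
  have : IsManifold (𝓡 m) (minSmoothness ℝ 3) M := by
    rw [minSmoothness_of_isRCLikeNormedField]; infer_instance
  have h : minSmoothness ℝ 2 ≤ (∞ : WithTop ℕ∞) := by
    rw [minSmoothness_of_isRCLikeNormedField]; exact WithTop.coe_le_coe.2 (le_top : (2 : ℕ∞) ≤ ⊤)
  exact VectorField.leibniz_identity_mlieBracket (hX.of_le h) (hY.of_le h) (hZ.of_le h)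

variable [T2Space M]

theorem SmoothG.dorfman {s t : GenSection m M} (hs : SmoothG s) (ht : SmoothG t) :
    SmoothG (dorfman s t) :=
  ⟨hs.1.mlieBracket ht.1,
    ContMDiff.sub_section (V := Cot m M) (ht.2.lieForm hs.1) (hs.2.dForm ht.1)⟩

/-- One-form parts may be compared on smooth test fields. -/
theorem gen_ext {s t : GenSection m M} (h1 : vec s = vec t)
    (h2 : ∀ W : VField m M, SmoothV W → contract W (frm s) = contract W (frm t)) : s = t :=
  funext fun p => Prod.ext (congrFun h1 p) (congrFun (oneForm_ext h2) p)

/-- The Leibniz (Jacobi) identity of the Dorfman bracket. The one-form parts are compared on a test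
field `W`; the two sides then differ by Jacobi identities of vector fields and by commutators of
second derivatives. -/
theorem dorfman_dorfman {s t u : GenSection m M} (hs : SmoothG s) (ht : SmoothG t)
    (hu : SmoothG u) :
    GenContact.dorfman s (GenContact.dorfman t u) =
      GenContact.dorfman (GenContact.dorfman s t) u
        + GenContact.dorfman t (GenContact.dorfman s u) := by
  refine gen_ext (mlieBracket_jacobi hs.1 ht.1 hu.1) fun W hW => ?_
  have e : contract W (frm (GenContact.dorfman (GenContact.dorfman s t) u
        + GenContact.dorfman t (GenContact.dorfman s u))) =
      contract W (frm (GenContact.dorfman (GenContact.dorfman s t) u)) +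
        contract W (frm (GenContact.dorfman t (GenContact.dorfman s u))) := rfl
  have v : ∀ a b : GenSection m M,
    vec (GenContact.dorfman a b) = VectorField.mlieBracket (𝓡 m) (vec a) (vec b) := fun _ _ => rfl
  have c : ∀ (A B : VField m M) (α : OneForm m M),
    contract (A + B) α = contract A α + contract B α :=
      fun A B α => funext fun p => (α p).map_add _ _
  rw [e, contract_frm_dorfman hs (ht.dorfman hu) hW, contract_frm_dorfman (hs.dorfman ht) hu hW,
    contract_frm_dorfman ht (hs.dorfman hu) hW,
    derivAlong_contract_frm_dorfman ht hu hW, derivAlong_contract_frm_dorfman hs ht hW,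
    derivAlong_contract_frm_dorfman hs ht hu.1, derivAlong_contract_frm_dorfman hs hu hW,
    contract_frm_dorfman ht hu (hs.1.mlieBracket hW),
    contract_frm_dorfman hs ht (hu.1.mlieBracket hW),
    contract_frm_dorfman hs hu (ht.1.mlieBracket hW), v, v, v]
  have j1 := congrArg (fun A => contract A (frm s)) (mlieBracket_jacobi ht.1 hu.1 hW)
  have j2 := congrArg (fun A => contract A (frm t)) (mlieBracket_jacobi hs.1 hu.1 hW)
  have j3 := congrArg (fun A => contract A (frm u)) (mlieBracket_jacobi hs.1 ht.1 hW)
  simp only [c] at j1 j2 j3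
  ext p
  have k1 := congrFun j1 p
  have k2 := congrFun j2 p
  have k3 := congrFun j3 p
  have d1 := derivAlong_mlieBracket ht.1 hu.1 (hs.2.contract hW) p
  have d2 := derivAlong_mlieBracket hs.1 hu.1 (ht.2.contract hW) p
  have d3 := derivAlong_mlieBracket hs.1 ht.1 (hu.2.contract hW) p
  have d4 := derivAlong_mlieBracket hs.1 hW (ht.2.contract hu.1) p
  have d5 := derivAlong_mlieBracket hu.1 hW (hs.2.contract ht.1) p
  have d6 := derivAlong_mlieBracket ht.1 hW (hs.2.contract hu.1) p
  simp only [Pi.add_apply, Pi.sub_apply] at k1 k2 k3 ⊢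
  linarith

theorem dorfman_smul_right {f : M → ℝ} {s t : GenSection m M} (hf : SmoothR m f) (hs : SmoothG s)
    (ht : SmoothG t) :
    GenContact.dorfman s (fun p => f p • t p) =
      (fun p => f p • GenContact.dorfman s t p) + fun p => derivAlong (vec s) f p • t p := by
  refine gen_ext ?_ fun W hW => ?_
  · funext p
    exact (VectorField.mlieBracket_smul_right (hf.mdifferentiableAt p)
      ((ht.1 p).mdifferentiableAt (by simp))).trans (add_comm _ _)
  · have e1 : ∀ V : VField m M, contract V (frm fun p => f p • t p) = f * contract V (frm t) :=
      fun V => rfl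
    have e2 : contract (vec fun p => f p • t p) (frm s) = f * contract (vec t) (frm s) :=
      funext fun p => (frm s p).map_smul (f p) _
    have e3 : derivAlong (vec fun p => f p • t p) (contract W (frm s)) =
        f * derivAlong (vec t) (contract W (frm s)) :=
      funext fun p => (dFun (contract W (frm s)) p).map_smul (f p) _
    have e4 : contract W (frm ((fun p => f p • GenContact.dorfman s t p)
        + fun p => derivAlong (vec s) f p • t p)) =
        f * contract W (frm (GenContact.dorfman s t)) + derivAlong (vec s) f * contract W (frm t) :=
      rfl
    have e5 : VectorField.mlieBracket (𝓡 m) (vec fun p => f p • t p) W =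
        fun p => - derivAlong W f p • vec t p
          + f p • VectorField.mlieBracket (𝓡 m) (vec t) W p := funext fun p =>
      VectorField.mlieBracket_smul_left (hf.mdifferentiableAt p)
        ((ht.1 p).mdifferentiableAt (by simp))
    have e6 : contract (VectorField.mlieBracket (𝓡 m) (vec fun p => f p • t p) W) (frm s) =
        f * contract (VectorField.mlieBracket (𝓡 m) (vec t) W) (frm s)
          - derivAlong W f * contract (vec t) (frm s) := by
      rw [e5]
      funext p
      refine ((frm s p).map_add _ _).trans ?_
      rw [(frm s p).map_smul, (frm s p).map_smul]
      change -derivAlong W f p * contract (vec t) (frm s) p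
        + f p * contract (VectorField.mlieBracket (𝓡 m) (vec t) W) (frm s) p = f p * _ - _ * _
      ring
    rw [contract_frm_dorfman hs (SmoothG.smul hf ht) hW, e1, e1, e2, e3, e4, e6,
      derivAlong_mul _ hf (ht.2.contract hW), derivAlong_mul _ hf (hs.2.contract ht.1),
      contract_frm_dorfman hs ht hW]
    ring

theorem dorfman_add_right {s t u : GenSection m M} (hs : SmoothG s) (ht : SmoothG t)
    (hu : SmoothG u) :
    GenContact.dorfman s (t + u) = GenContact.dorfman s t + GenContact.dorfman s u := by
  refine gen_ext ?_ fun W hW => ?_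
  · funext p
    exact VectorField.mlieBracket_add_right ((ht.1 p).mdifferentiableAt (by simp))
      ((hu.1 p).mdifferentiableAt (by simp))
  · have e1 : ∀ V : VField m M,
        contract V (frm (t + u)) = contract V (frm t) + contract V (frm u) := fun V => rfl
    have e2 : contract (vec (t + u)) (frm s) =
        contract (vec t) (frm s) + contract (vec u) (frm s) :=
      funext fun p => (frm s p).map_add _ _
    have e3 : derivAlong (vec (t + u)) (contract W (frm s)) =
        derivAlong (vec t) (contract W (frm s)) + derivAlong (vec u) (contract W (frm s)) :=
      funext fun p => (dFun (contract W (frm s)) p).map_add _ _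
    have e4 : contract W (frm (GenContact.dorfman s t + GenContact.dorfman s u)) =
        contract W (frm (GenContact.dorfman s t)) + contract W (frm (GenContact.dorfman s u)) := rfl
    have e5 : VectorField.mlieBracket (𝓡 m) (vec (t + u)) W =
        VectorField.mlieBracket (𝓡 m) (vec t) W + VectorField.mlieBracket (𝓡 m) (vec u) W :=
      funext fun p => VectorField.mlieBracket_add_left ((ht.1 p).mdifferentiableAt (by simp))
        ((hu.1 p).mdifferentiableAt (by simp))
    have e6 : contract (VectorField.mlieBracket (𝓡 m) (vec (t + u)) W) (frm s) =
        contract (VectorField.mlieBracket (𝓡 m) (vec t) W) (frm s)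
          + contract (VectorField.mlieBracket (𝓡 m) (vec u) W) (frm s) := by
      rw [e5]
      exact funext fun p => (frm s p).map_add _ _
    rw [contract_frm_dorfman hs (ht.add hu) hW, e1, e1, e2, e3, e4, e6,
      derivAlong_add _ (ht.2.contract hW) (hu.2.contract hW),
      derivAlong_add _ (hs.2.contract ht.1) (hs.2.contract hu.1),
      contract_frm_dorfman hs ht hW, contract_frm_dorfman hs hu hW]
    abel

theorem dorfman_add_left {s t u : GenSection m M} (hs : SmoothG s) (ht : SmoothG t)
    (hu : SmoothG u) :
    GenContact.dorfman (s + t) u = GenContact.dorfman s u + GenContact.dorfman t u := by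
  -- The symmetric part is additive, so additivity on the right carries over to the left.
  have h1 := dGen_pairF hs hu
  have h2 := dGen_pairF ht hu
  have h3 := dGen_pairF (hs.add ht) hu
  have h4 : 2 * pairF (s + t) u = 2 * pairF s u + 2 * pairF t u := by
    rw [pairF_add_left, mul_add]
  have h5 : ∀ v w : GenSection m M, 2 * pairF v w = (2 : ℝ) • pairF v w := fun v w => by
    ext p; simp
  rw [h4, dGen_add, h1, h2, dorfman_add_right hu hs ht] at h3
  · rw [eq_sub_of_add_eq h3.symm]; abel
  · rw [h5]; exact SmoothR.const_smul _ (hs.pairF hu)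
  · rw [h5]; exact SmoothR.const_smul _ (ht.pairF hu)

theorem dorfman_neg_right {s t : GenSection m M} (hs : SmoothG s) (ht : SmoothG t) :
    GenContact.dorfman s (-t) = -GenContact.dorfman s t := by
  have h := dorfman_add_right hs ht ht.neg
  have h0 := dorfman_add_right hs ht (ht.sub ht)
  rw [sub_self, add_zero] at h0
  rw [add_neg_cancel, left_eq_add.1 h0] at h
  exact (neg_eq_of_add_eq_zero_right h.symm).symm

theorem dorfman_neg_left {s t : GenSection m M} (hs : SmoothG s) (ht : SmoothG t) :
    GenContact.dorfman (-s) t = -GenContact.dorfman s t := by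
  have h := dorfman_add_left hs hs.neg ht
  have h0 := dorfman_add_left hs (hs.sub hs) ht
  rw [sub_self, add_zero] at h0
  rw [add_neg_cancel, left_eq_add.1 h0] at h
  exact (neg_eq_of_add_eq_zero_right h.symm).symm

theorem dorfman_sub_right {s t u : GenSection m M} (hs : SmoothG s) (ht : SmoothG t)
    (hu : SmoothG u) :
    GenContact.dorfman s (t - u) = GenContact.dorfman s t - GenContact.dorfman s u := by
  rw [sub_eq_add_neg, dorfman_add_right hs ht hu.neg, dorfman_neg_right hs hu, sub_eq_add_neg]

theorem dorfman_sub_left {s t u : GenSection m M} (hs : SmoothG s) (ht : SmoothG t)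
    (hu : SmoothG u) :
    GenContact.dorfman (s - t) u = GenContact.dorfman s u - GenContact.dorfman t u := by
  rw [sub_eq_add_neg, dorfman_add_left hs ht.neg hu, dorfman_neg_left ht hu, sub_eq_add_neg]

end

end GenContact

/-! ### The complex Dorfman bracket -/

namespace Complexification

variable {V : Type*} [AddCommGroup V]

@[simp] theorem sub_re (x y : Complexification V) : (x - y).re = x.re - y.re := by
  rw [sub_eq_add_neg, sub_eq_add_neg]; rfl

@[simp] theorem sub_im (x y : Complexification V) : (x - y).im = x.im - y.im := by
  rw [sub_eq_add_neg, sub_eq_add_neg]; rfl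

end Complexification

namespace GenContact

section

variable {m : ℕ} {M : Type*} [TopologicalSpace M] [ChartedSpace (EuclideanSpace ℝ (Fin m)) M]

/-- The complex-bilinear Dorfman bracket. -/
noncomputable def cDorfman (s t : CSection m M) : CSection m M :=
  Complexification.bilin dorfman s t

/-- The complex section `df` of `T*M_ℂ`. -/
noncomputable def cdGen (f : CFun M) : CSection m M := Complexification.map dGen f

theorem pairF_sub_left (s t u : GenSection m M) : pairF (s - t) u = pairF s u - pairF t u := by
  rw [sub_eq_add_neg, pairF_add_left, pairF_neg_left, sub_eq_add_neg]

theorem pairF_add_right (s t u : GenSection m M) : pairF s (t + u) = pairF s t + pairF s u := by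
  rw [pairF_comm, pairF_add_left, pairF_comm t, pairF_comm u]

theorem pairF_sub_right (s t u : GenSection m M) : pairF s (t - u) = pairF s t - pairF s u := by
  rw [pairF_comm, pairF_sub_left, pairF_comm t, pairF_comm u]

theorem sPairing_re (s t : CSection m M) :
    (sPairing s t).re = pairF s.re t.re - pairF s.im t.im := rfl

theorem sPairing_im (s t : CSection m M) :
    (sPairing s t).im = pairF s.re t.im + pairF s.im t.re := rfl

theorem cDorfman_re (s t : CSection m M) :
    (cDorfman s t).re = dorfman s.re t.re - dorfman s.im t.im := rfl

theorem cDorfman_im (s t : CSection m M) :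
    (cDorfman s t).im = dorfman s.re t.im + dorfman s.im t.re := rfl

theorem cDeriv_anchor_re (s : CSection m M) (f : CFun M) :
    (cDeriv (anchor s) f).re = derivAlong (vec s.re) f.re - derivAlong (vec s.im) f.im := rfl

theorem cDeriv_anchor_im (s : CSection m M) (f : CFun M) :
    (cDeriv (anchor s) f).im = derivAlong (vec s.re) f.im + derivAlong (vec s.im) f.re := rfl

theorem cdGen_re (f : CFun M) : (cdGen (m := m) f).re = dGen f.re := rfl

theorem cdGen_im (f : CFun M) : (cdGen (m := m) f).im = dGen f.im := rfl

theorem sPairing_comm (s t : CSection m M) : sPairing s t = sPairing t s := by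
  ext1
  · rw [sPairing_re, sPairing_re, pairF_comm, pairF_comm s.im]
  · rw [sPairing_im, sPairing_im, pairF_comm, pairF_comm s.im, add_comm]

theorem sPairing_add_left (s t u : CSection m M) :
    sPairing (s + t) u = sPairing s u + sPairing t u := by
  ext1
  · simp only [sPairing_re, Complexification.add_re, Complexification.add_im, pairF_add_left]; abel
  · simp only [sPairing_im, Complexification.add_re, Complexification.add_im, pairF_add_left]; abel

theorem sPairing_sub_left (s t u : CSection m M) :
    sPairing (s - t) u = sPairing s u - sPairing t u := by
  rw [eq_sub_iff_add_eq, ← sPairing_add_left, sub_add_cancel]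

theorem sPairing_cdGen {f : CFun M} {s : CSection m M} :
    sPairing (cdGen f) s + sPairing (cdGen f) s = cDeriv (anchor s) f := by
  have e : ∀ (g : M → ℝ) (t : GenSection m M),
      pairF (dGen g) t + pairF (dGen g) t = derivAlong (vec t) g := fun g t => by
    funext p
    have h : pairF (dGen g) t p = 1 / 2 * ((t p).2 0 + derivAlong (vec t) g p) := rfl
    rw [Pi.add_apply, h, map_zero]; ring
  ext1
  · simp only [Complexification.add_re, sPairing_re, cdGen_re, cdGen_im, cDeriv_anchor_re, ← e]
    abel
  · simp only [Complexification.add_im, sPairing_im, cdGen_re, cdGen_im, cDeriv_anchor_im, ← e]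
    abel

theorem anchor_cDorfman (s t : CSection m M) :
    anchor (cDorfman s t) = cLie (anchor s) (anchor t) := rfl

variable [IsManifold (𝓡 m) ∞ M]

/-- Smoothness of a complex section. -/
def SmoothCS (s : CSection m M) : Prop := SmoothG s.re ∧ SmoothG s.im

theorem SmoothCS.add {s t : CSection m M} (hs : SmoothCS s) (ht : SmoothCS t) :
    SmoothCS (s + t) := ⟨hs.1.add ht.1, hs.2.add ht.2⟩

theorem SmoothCS.sPairing {s t : CSection m M} (hs : SmoothCS s) (ht : SmoothCS t) :
    SmoothC (m := m) (sPairing s t) :=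
  ⟨SmoothR.sub (hs.1.pairF ht.1) (hs.2.pairF ht.2), SmoothR.add (hs.1.pairF ht.2) (hs.2.pairF ht.1)⟩

theorem SmoothCS.fsmul {f : CFun M} {s : CSection m M} (hf : SmoothC (m := m) f)
    (hs : SmoothCS s) : SmoothCS (fsmul f s) :=
  ⟨(SmoothG.smul hf.1 hs.1).sub (SmoothG.smul hf.2 hs.2),
    (SmoothG.smul hf.1 hs.2).add (SmoothG.smul hf.2 hs.1)⟩

/-- The Courant bracket is the Dorfman bracket corrected by an exact term. -/
theorem cCourant_eq {s t : CSection m M} (hs : SmoothCS s) (ht : SmoothCS t) :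
    cCourant s t = cDorfman s t - cdGen (sPairing s t) := by
  ext1
  · change courant _ _ - courant _ _ = _
    rw [courant_eq hs.1 ht.1, courant_eq hs.2 ht.2, Complexification.sub_re, cdGen_re, sPairing_re,
      dGen_sub (hs.1.pairF ht.1) (hs.2.pairF ht.2), cDorfman_re]
    abel
  · change courant _ _ + courant _ _ = _
    rw [courant_eq hs.1 ht.2, courant_eq hs.2 ht.1, Complexification.sub_im, cdGen_im, sPairing_im,
      dGen_add (hs.1.pairF ht.2) (hs.2.pairF ht.1), cDorfman_im]
    abel

/-- The pairing is invariant under the Dorfman bracket. -/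
theorem cDeriv_sPairing {s t u : CSection m M} (hs : SmoothCS s) (ht : SmoothCS t)
    (hu : SmoothCS u) :
    cDeriv (anchor s) (sPairing t u) =
      sPairing (cDorfman s t) u + sPairing t (cDorfman s u) := by
  ext1
  · rw [cDeriv_anchor_re, sPairing_re, sPairing_im,
      derivAlong_sub _ (ht.1.pairF hu.1) (ht.2.pairF hu.2),
      derivAlong_add _ (ht.1.pairF hu.2) (ht.2.pairF hu.1),
      derivAlong_pairF_eq hs.1 ht.1 hu.1, derivAlong_pairF_eq hs.1 ht.2 hu.2,
      derivAlong_pairF_eq hs.2 ht.1 hu.2, derivAlong_pairF_eq hs.2 ht.2 hu.1]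
    simp only [Complexification.add_re, sPairing_re, cDorfman_re, cDorfman_im, pairF_add_left,
      pairF_sub_left, pairF_add_right, pairF_sub_right]
    abel
  · rw [cDeriv_anchor_im, sPairing_re, sPairing_im,
      derivAlong_sub _ (ht.1.pairF hu.1) (ht.2.pairF hu.2),
      derivAlong_add _ (ht.1.pairF hu.2) (ht.2.pairF hu.1),
      derivAlong_pairF_eq hs.2 ht.1 hu.1, derivAlong_pairF_eq hs.2 ht.2 hu.2,
      derivAlong_pairF_eq hs.1 ht.1 hu.2, derivAlong_pairF_eq hs.1 ht.2 hu.1]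
    simp only [Complexification.add_im, sPairing_im, cDorfman_re, cDorfman_im, pairF_add_left,
      pairF_sub_left, pairF_add_right, pairF_sub_right]
    abel

theorem dorfman_add_dorfman {s t : GenSection m M} (hs : SmoothG s) (ht : SmoothG t) :
    dorfman s t + dorfman t s = dGen (pairF s t) + dGen (pairF t s) := by
  rw [← dGen_pairF hs ht, two_mul, dGen_add (hs.pairF ht) (hs.pairF ht), pairF_comm t]

theorem cDorfman_add_cDorfman {s t : CSection m M} (hs : SmoothCS s) (ht : SmoothCS t) :
    cDorfman s t + cDorfman t s = cdGen (sPairing s t) + cdGen (sPairing t s) := by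
  ext1
  · have h1 := dorfman_add_dorfman hs.1 ht.1
    have h2 := dorfman_add_dorfman hs.2 ht.2
    simp only [Complexification.add_re, cDorfman_re, cdGen_re, sPairing_re]
    rw [dGen_sub (hs.1.pairF ht.1) (hs.2.pairF ht.2), dGen_sub (ht.1.pairF hs.1) (ht.2.pairF hs.2),
      sub_add_sub_comm, sub_add_sub_comm, h1, h2]
  · have h1 := dorfman_add_dorfman hs.1 ht.2
    have h2 := dorfman_add_dorfman hs.2 ht.1
    simp only [Complexification.add_im, cDorfman_im, cdGen_im, sPairing_im]
    rw [dGen_add (hs.1.pairF ht.2) (hs.2.pairF ht.1), dGen_add (ht.1.pairF hs.2) (ht.2.pairF hs.1),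
      add_comm (dorfman t.re _), add_comm (dGen (pairF t.re _)), add_add_add_comm,
      add_add_add_comm (dGen _), h1, h2]

variable [T2Space M]

theorem SmoothCS.cDorfman {s t : CSection m M} (hs : SmoothCS s) (ht : SmoothCS t) :
    SmoothCS (cDorfman s t) :=
  ⟨(hs.1.dorfman ht.1).sub (hs.2.dorfman ht.2), (hs.1.dorfman ht.2).add (hs.2.dorfman ht.1)⟩

/-- The Leibniz (Jacobi) identity of the Dorfman bracket. -/
theorem cDorfman_cDorfman {s t u : CSection m M} (hs : SmoothCS s) (ht : SmoothCS t)
    (hu : SmoothCS u) :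
    GenContact.cDorfman s (GenContact.cDorfman t u) =
      GenContact.cDorfman (GenContact.cDorfman s t) u
        + GenContact.cDorfman t (GenContact.cDorfman s u) := by
  ext1
  · simp only [Complexification.add_re, cDorfman_re, cDorfman_im]
    rw [dorfman_sub_right hs.1 (ht.1.dorfman hu.1) (ht.2.dorfman hu.2),
      dorfman_add_right hs.2 (ht.1.dorfman hu.2) (ht.2.dorfman hu.1),
      dorfman_sub_left (hs.1.dorfman ht.1) (hs.2.dorfman ht.2) hu.1,
      dorfman_add_left (hs.1.dorfman ht.2) (hs.2.dorfman ht.1) hu.2,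
      dorfman_sub_right ht.1 (hs.1.dorfman hu.1) (hs.2.dorfman hu.2),
      dorfman_add_right ht.2 (hs.1.dorfman hu.2) (hs.2.dorfman hu.1),
      dorfman_dorfman hs.1 ht.1 hu.1, dorfman_dorfman hs.1 ht.2 hu.2,
      dorfman_dorfman hs.2 ht.1 hu.2, dorfman_dorfman hs.2 ht.2 hu.1]
    abel
  · simp only [Complexification.add_im, cDorfman_re, cDorfman_im]
    rw [dorfman_sub_right hs.2 (ht.1.dorfman hu.1) (ht.2.dorfman hu.2),
      dorfman_add_right hs.1 (ht.1.dorfman hu.2) (ht.2.dorfman hu.1),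
      dorfman_sub_left (hs.1.dorfman ht.1) (hs.2.dorfman ht.2) hu.2,
      dorfman_add_left (hs.1.dorfman ht.2) (hs.2.dorfman ht.1) hu.1,
      dorfman_sub_right ht.2 (hs.1.dorfman hu.1) (hs.2.dorfman hu.2),
      dorfman_add_right ht.1 (hs.1.dorfman hu.2) (hs.2.dorfman hu.1),
      dorfman_dorfman hs.2 ht.1 hu.1, dorfman_dorfman hs.2 ht.2 hu.2,
      dorfman_dorfman hs.1 ht.1 hu.2, dorfman_dorfman hs.1 ht.2 hu.1]
    abel

theorem cDorfman_fsmul {f : CFun M} {s t : CSection m M} (hf : SmoothC (m := m) f)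
    (hs : SmoothCS s) (ht : SmoothCS t) :
    GenContact.cDorfman s (GenContact.fsmul f t) =
      GenContact.fsmul f (GenContact.cDorfman s t)
        + GenContact.fsmul (cDeriv (anchor s) f) t := by
  have hr : (GenContact.fsmul f t).re = (fun p => f.re p • t.re p) - fun p => f.im p • t.im p := rfl
  have hi : (GenContact.fsmul f t).im = (fun p => f.re p • t.im p) + fun p => f.im p • t.re p := rfl
  ext1
  · rw [cDorfman_re, hr, hi,
      dorfman_sub_right hs.1 (SmoothG.smul hf.1 ht.1) (SmoothG.smul hf.2 ht.2),
      dorfman_add_right hs.2 (SmoothG.smul hf.1 ht.2) (SmoothG.smul hf.2 ht.1),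
      dorfman_smul_right hf.1 hs.1 ht.1, dorfman_smul_right hf.2 hs.1 ht.2,
      dorfman_smul_right hf.1 hs.2 ht.2, dorfman_smul_right hf.2 hs.2 ht.1]
    funext p
    simp only [fsmul, cDeriv, anchor, cDorfman, Complexification.bilin, Complexification.map,
      Complexification.add_re, Pi.add_apply, Pi.sub_apply]
    module
  · rw [cDorfman_im, hr, hi,
      dorfman_sub_right hs.2 (SmoothG.smul hf.1 ht.1) (SmoothG.smul hf.2 ht.2),
      dorfman_add_right hs.1 (SmoothG.smul hf.1 ht.2) (SmoothG.smul hf.2 ht.1),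
      dorfman_smul_right hf.1 hs.2 ht.1, dorfman_smul_right hf.2 hs.2 ht.2,
      dorfman_smul_right hf.1 hs.1 ht.2, dorfman_smul_right hf.2 hs.1 ht.1]
    funext p
    simp only [fsmul, cDeriv, anchor, cDorfman, Complexification.bilin, Complexification.map,
      Complexification.add_im, Pi.add_apply, Pi.sub_apply]
    module

end

end GenContact

/-! ### Isotropic families of subspaces -/

namespace GenContact

section

variable {m : ℕ} {M : Type*} [TopologicalSpace M] [ChartedSpace (EuclideanSpace ℝ (Fin m)) M]

theorem cDeriv_neg (X : CVField m M) (f : CFun M) : cDeriv X (-f) = -cDeriv X f := by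
  have h : ∀ (Y : VField m M) (g : M → ℝ), derivAlong Y (-g) = -derivAlong Y g := fun Y g =>
    funext fun p => by
      have e : mfderiv (𝓡 m) 𝓘(ℝ, ℝ) (-g) p = -mfderiv (𝓡 m) 𝓘(ℝ, ℝ) g p := mfderiv_neg
      exact DFunLike.congr_fun e (Y p)
  ext1
  · simp only [cDeriv, Complexification.bilin, Complexification.neg_re, Complexification.neg_im, h]
    abel
  · simp only [cDeriv, Complexification.bilin, Complexification.neg_re, Complexification.neg_im, h]
    abel

theorem cDeriv_zero (X : CVField m M) : cDeriv X 0 = 0 := by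
  have h := cDeriv_neg X 0
  rw [neg_zero] at h
  have h2 : ∀ (Y : VField m M), derivAlong Y (0 : M → ℝ) = 0 := fun Y => funext fun p =>
    DFunLike.congr_fun (mfderiv_const (I := 𝓡 m) (I' := 𝓘(ℝ, ℝ)) (c := (0 : ℝ)) (x := p)) (Y p)
  ext1
  · simp only [cDeriv, Complexification.bilin, Complexification.zero_re,
      Complexification.zero_im, h2]
    abel
  · simp only [cDeriv, Complexification.bilin, Complexification.zero_re,
      Complexification.zero_im, h2]
    abel

theorem cdGen_zero : cdGen (m := m) (0 : CFun M) = 0 := by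
  have h : dGen (m := m) (0 : M → ℝ) = 0 := funext fun p =>
    Prod.ext rfl (mfderiv_const (I := 𝓡 m) (I' := 𝓘(ℝ, ℝ)) (c := (0 : ℝ)) (x := p))
  ext1
  · exact h
  · exact h

variable [IsManifold (𝓡 m) ∞ M]

theorem smoothCS_of_mem {A : CSub m M} {s : CSection m M} (hs : s ∈ Sec A) : SmoothCS s :=
  ⟨hs.1, hs.2.1⟩

/-- The pairing vanishes on `Γ(A)`. -/
def IsIsotropic (A : CSub m M) : Prop := ∀ s ∈ Sec A, ∀ t ∈ Sec A, sPairing s t = 0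

theorem IsIsotropic.cCourant_eq {A : CSub m M} (hA : IsIsotropic A) {s t : CSection m M}
    (hs : s ∈ Sec A) (ht : t ∈ Sec A) : cCourant s t = cDorfman s t := by
  rw [GenContact.cCourant_eq (smoothCS_of_mem hs) (smoothCS_of_mem ht), hA s hs t ht, cdGen_zero,
    sub_zero]

theorem IsIsotropic.cDorfman_skew {A : CSub m M} (hA : IsIsotropic A) {s t : CSection m M}
    (hs : s ∈ Sec A) (ht : t ∈ Sec A) : cDorfman s t = -cDorfman t s := by
  have h := cDorfman_add_cDorfman (smoothCS_of_mem hs) (smoothCS_of_mem ht)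
  rw [hA s hs t ht, hA t ht s hs, cdGen_zero, add_zero] at h
  exact eq_neg_of_add_eq_zero_left h

theorem fsmul_mem_sec {A : CSub m M} {f : CFun M} (hf : SmoothC (m := m) f) {s : CSection m M}
    (hs : s ∈ Sec A) : fsmul f s ∈ Sec A := by
  have h := SmoothCS.fsmul hf (smoothCS_of_mem hs)
  refine ⟨h.1, h.2, fun p => ?_⟩
  have e : evalAt (fsmul f s) p = (⟨f.re p, f.im p⟩ : ℂ) • evalAt s p := by
    ext1
    · rfl
    · rfl
  rw [e]
  exact (A p).smul_mem _ (hs.2.2 p)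

theorem IsIsotropic.sPairing_cDorfman {B : CSub m M} (hB : IsIsotropic B) {a σ τ : CSection m M}
    (ha : SmoothCS a) (hσ : σ ∈ Sec B) (hτ : τ ∈ Sec B) :
    sPairing (cDorfman a σ) τ = -sPairing σ (cDorfman a τ) := by
  have h := cDeriv_sPairing ha (smoothCS_of_mem hσ) (smoothCS_of_mem hτ)
  rw [hB σ hσ τ hτ, cDeriv_zero] at h
  exact eq_neg_of_add_eq_zero_left h.symm

/-- On an isotropic family `B` the differential is `(d_B a)(σ, τ) = -⟨a ∘ σ, τ⟩`. -/
theorem IsIsotropic.dDual_eq {B : CSub m M} (hB : IsIsotropic B) {a σ τ : CSection m M}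
    (ha : SmoothCS a) (hσ : σ ∈ Sec B) (hτ : τ ∈ Sec B) :
    dDual a σ τ = -sPairing (cDorfman a σ) τ := by
  have hs := smoothCS_of_mem hσ
  have ht := smoothCS_of_mem hτ
  unfold dDual
  rw [hB.cCourant_eq hσ hτ, cDeriv_sPairing hs ha ht, ← sPairing_cdGen,
    eq_sub_of_add_eq (cDorfman_add_cDorfman hs ha), sPairing_sub_left, sPairing_add_left,
    sPairing_comm σ a]
  abel

/-- The Lie derivative `L_a σ` is the part of the Dorfman bracket `a ∘ σ` that pairs with `Γ(A)`. -/
theorem sPairing_lie {A B : CSub m M} (hA : IsIsotropic A) {a σ l a' : CSection m M}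
    (ha : a ∈ Sec A) (hσ : σ ∈ Sec B) (hl : IsLieDerivative A B a σ l) (ha' : a' ∈ Sec A) :
    sPairing l a' = sPairing (cDorfman a σ) a' := by
  rw [hl.2 a' ha', hA.cCourant_eq ha ha', cDeriv_sPairing (smoothCS_of_mem ha) (smoothCS_of_mem hσ)
    (smoothCS_of_mem ha')]
  abel

variable [T2Space M]

theorem cDorfman_neg_right {s t : CSection m M} (hs : SmoothCS s) (ht : SmoothCS t) :
    cDorfman s (-t) = -cDorfman s t := by
  ext1
  · simp only [cDorfman_re, Complexification.neg_re, Complexification.neg_im]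
    rw [dorfman_neg_right hs.1 ht.1, dorfman_neg_right hs.2 ht.2]
    abel
  · simp only [cDorfman_im, Complexification.neg_re, Complexification.neg_im]
    rw [dorfman_neg_right hs.1 ht.2, dorfman_neg_right hs.2 ht.1]
    abel

/-- An isotropic family that is closed under the Courant bracket is a Lie algebroid: on its
sections the Courant bracket agrees with the Dorfman bracket, which is then skew and satisfies the
Leibniz identities. -/
theorem IsIsotropic.isLieAlgebroid {A : CSub m M} (hA : IsIsotropic A) (hc : CourantClosed A) :
    IsLieAlgebroid A where
  closed := hc
  skew s hs t ht := by
    rw [hA.cCourant_eq hs ht, hA.cCourant_eq ht hs, hA.cDorfman_skew hs ht]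
  jacobi s hs t ht u hu := by
    rw [hA.cCourant_eq (hc s hs t ht) hu, hA.cCourant_eq (hc t ht u hu) hs,
      hA.cCourant_eq (hc u hu s hs) ht, hA.cDorfman_skew (hc t ht u hu) hs,
      hA.cDorfman_skew (hc u hu s hs) ht]
    have h1 : cCourant u s = -cDorfman s u := by
      rw [hA.cCourant_eq hu hs, hA.cDorfman_skew hu hs]
    have ss := smoothCS_of_mem hs
    have st := smoothCS_of_mem ht
    have su := smoothCS_of_mem hu
    rw [h1, cDorfman_neg_right st (ss.cDorfman su), hA.cCourant_eq hs ht, hA.cCourant_eq ht hu,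
      cDorfman_cDorfman ss st su]
    abel
  leibniz s hs t ht f hf := by
    rw [hA.cCourant_eq hs (fsmul_mem_sec hf ht), hA.cCourant_eq hs ht,
      cDorfman_fsmul hf (smoothCS_of_mem hs) (smoothCS_of_mem ht)]
  anchor_bracket s hs t ht := by
    rw [hA.cCourant_eq hs ht, anchor_cDorfman]

/-- For isotropic `A`, `B`, the defect of the derivation property of `d_B`, written through the
Dorfman bracket. The second derivatives cancel by the Leibniz identity for `a`, `b`, `σ`. -/
theorem defect_eq {A B : CSub m M} (hA : IsIsotropic A) (hB : IsIsotropic B)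
    {Lie : CSection m M → CSection m M → CSection m M}
    (hLie : ∀ a ∈ Sec A, ∀ σ ∈ Sec B, IsLieDerivative A B a σ (Lie a σ))
    {a b σ τ : CSection m M} (ha : a ∈ Sec A) (hb : b ∈ Sec A) (hσ : σ ∈ Sec B) (hτ : τ ∈ Sec B) :
    dDual (cCourant a b) σ τ - (-schouten Lie b (dDual a) σ τ + schouten Lie a (dDual b) σ τ) =
      (sPairing (cDorfman b σ) (cDorfman a τ) - sPairing (Lie b σ) (cDorfman a τ)
        - sPairing (cDorfman b σ) (Lie a τ))
      - (sPairing (cDorfman a σ) (cDorfman b τ) - sPairing (Lie a σ) (cDorfman b τ)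
        - sPairing (cDorfman a σ) (Lie b τ)) := by
  have sa := smoothCS_of_mem ha
  have sb := smoothCS_of_mem hb
  have ss := smoothCS_of_mem hσ
  have st := smoothCS_of_mem hτ
  have laσ := (hLie a ha σ hσ).1
  have lbσ := (hLie b hb σ hσ).1
  have laτ := (hLie a ha τ hτ).1
  have lbτ := (hLie b hb τ hτ).1
  unfold schouten
  rw [hA.cCourant_eq ha hb, hB.dDual_eq (sa.cDorfman sb) hσ hτ, hB.dDual_eq sa hσ hτ,
    hB.dDual_eq sb hσ hτ, hB.dDual_eq sa lbσ hτ, hB.dDual_eq sa hσ lbτ, hB.dDual_eq sb laσ hτ,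
    hB.dDual_eq sb hσ laτ, cDeriv_neg, cDeriv_neg, cDeriv_sPairing sb (sa.cDorfman ss) st,
    cDeriv_sPairing sa (sb.cDorfman ss) st, cDorfman_cDorfman sa sb ss, sPairing_add_left,
    hB.sPairing_cDorfman sa lbσ hτ, hB.sPairing_cDorfman sb laσ hτ]
  abel

end

end GenContact

/-! ### The pointwise algebra of a generalized almost contact pair -/

namespace GenContact

section
theorem cFun_ext {M : Type*} {f g : CFun M}
    (h : ∀ p, (⟨f.re p, f.im p⟩ : ℂ) = ⟨g.re p, g.im p⟩) : f = g := by
  ext p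
  · exact congrArg Complex.re (h p)
  · exact congrArg Complex.im (h p)

variable {m : ℕ} {M : Type*} [TopologicalSpace M] [ChartedSpace (EuclideanSpace ℝ (Fin m)) M]

theorem pairing_comm {p : M} (u v : Gen m M p) : pairing u v = pairing v u := by
  unfold pairing; ring

theorem pairing_add_left {p : M} (u v w : Gen m M p) :
    pairing (u + v) w = pairing u w + pairing v w := by
  have h : w.2 (u + v).1 = w.2 u.1 + w.2 v.1 := map_add _ _ _
  have h2 : (u + v).2 w.1 = u.2 w.1 + v.2 w.1 := rfl
  unfold pairing
  rw [h, h2]; ring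

theorem pairing_smul_left {p : M} (c : ℝ) (u w : Gen m M p) :
    pairing (c • u) w = c * pairing u w := by
  have h : w.2 (c • u).1 = c * w.2 u.1 := map_smul _ _ _
  have h2 : (c • u).2 w.1 = c * u.2 w.1 := rfl
  unfold pairing
  rw [h, h2]; ring

theorem pairing_sub_left {p : M} (u v w : Gen m M p) :
    pairing (u - v) w = pairing u w - pairing v w := by
  rw [eq_sub_iff_add_eq, ← pairing_add_left, sub_add_cancel]

/-- The complex-bilinear pairing on a fibre, with values in `ℂ`. -/
noncomputable def cp {p : M} :
    Complexification (Gen m M p) →ₗ[ℂ] Complexification (Gen m M p) →ₗ[ℂ] ℂ :=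
  have hc : ∀ x y : Complexification (Gen m M p), (⟨(cPairing x y).re, (cPairing x y).im⟩ : ℂ) =
      ⟨(cPairing y x).re, (cPairing y x).im⟩ := fun x y => by
    apply Complex.ext <;>
      simp only [cPairing, Complexification.bilin, pairing_comm x.re, pairing_comm x.im]
    exact add_comm _ _
  have ha : ∀ x y z : Complexification (Gen m M p),
      (⟨(cPairing (x + y) z).re, (cPairing (x + y) z).im⟩ : ℂ) =
      ⟨(cPairing x z).re, (cPairing x z).im⟩ + ⟨(cPairing y z).re, (cPairing y z).im⟩ :=
    fun x y z => by
      apply Complex.ext <;>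
        simp only [cPairing, Complexification.bilin, Complexification.add_re,
          Complexification.add_im, pairing_add_left, Complex.add_re, Complex.add_im] <;> ring
  have hs : ∀ (c : ℂ) (x z : Complexification (Gen m M p)),
      (⟨(cPairing (c • x) z).re, (cPairing (c • x) z).im⟩ : ℂ) =
      c • (⟨(cPairing x z).re, (cPairing x z).im⟩ : ℂ) :=
    fun c x z => by
      apply Complex.ext <;>
        simp only [cPairing, Complexification.bilin, Complexification.smul_re, smul_eq_mul,
          Complexification.smul_im, pairing_add_left, pairing_sub_left, pairing_smul_left,
          Complex.mul_re, Complex.mul_im] <;> ring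
  LinearMap.mk₂ ℂ (fun x y => ⟨(cPairing x y).re, (cPairing x y).im⟩) ha hs
    (fun x y z => by rw [hc, ha, hc y, hc z]) (fun c x z => by rw [hc, hs, hc z])

theorem cp_apply {p : M} (x y : Complexification (Gen m M p)) :
    cp x y = ⟨(cPairing x y).re, (cPairing x y).im⟩ := rfl

theorem cp_comm {p : M} (x y : Complexification (Gen m M p)) : cp x y = cp y x := by
  apply Complex.ext <;>
    simp only [cp_apply, cPairing, Complexification.bilin, pairing_comm x.re, pairing_comm x.im]
  exact add_comm _ _

theorem cp_eq_zero_iff {p : M} (x y : Complexification (Gen m M p)) :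
    cPairing x y = 0 ↔ cp x y = 0 := by
  rw [Complexification.ext_iff, Complex.ext_iff]; rfl

theorem exists_clm_ne_zero {x : EuclideanSpace ℝ (Fin m)} (hx : x ≠ 0) :
    ∃ f : EuclideanSpace ℝ (Fin m) →L[ℝ] ℝ, f x ≠ 0 :=
  SeparatingDual.exists_ne_zero hx

theorem pairing_nondegenerate {p : M} {u : Gen m M p} (h : ∀ v, pairing u v = 0) : u = 0 := by
  refine Prod.ext ?_ ?_
  · by_contra h0
    obtain ⟨f, hf⟩ := exists_clm_ne_zero h0
    have := h (0, f)
    have e : pairing u (0, f) = 1 / 2 * (f u.1 + u.2 0) := rfl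
    rw [e, map_zero] at this
    exact hf (by linarith)
  · ext v
    have := h (v, 0)
    have e : pairing u (v, 0) = 1 / 2 * (0 + u.2 v) := rfl
    rw [e] at this
    exact (by linarith : u.2 v = 0)

theorem cp_nondegenerate {p : M} {x : Complexification (Gen m M p)} (h : ∀ y, cp x y = 0) :
    x = 0 := by
  have h2 : ∀ v : Gen m M p, pairing x.re v = 0 ∧ pairing x.im v = 0 := fun v => by
    have h3 := Complex.ext_iff.1 (h ⟨v, 0⟩)
    have e0 : ∀ u : Gen m M p, pairing u 0 = 0 := fun u => by
      have : pairing u (0 : Gen m M p) = 1 / 2 * (0 + u.2 0) := rfl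
      rw [this, map_zero]; ring
    simp only [cp_apply, cPairing, Complexification.bilin, e0, Complex.zero_re, Complex.zero_im]
      at h3
    exact ⟨by linarith [h3.1], by linarith [h3.2]⟩
  ext1
  · exact pairing_nondegenerate fun v => (h2 v).1
  · exact pairing_nondegenerate fun v => (h2 v).2

theorem I_smul_I_smul {p : M} (x : Complexification (Gen m M p)) :
    Complex.I • Complex.I • x = -x := by
  rw [smul_smul, Complex.I_mul_I, neg_one_smul]

theorem sPairing_apply (s t : CSection m M) (p : M) :
    (⟨(sPairing s t).re p, (sPairing s t).im p⟩ : ℂ) = cp (evalAt s p) (evalAt t p) := rfl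

variable [IsManifold (𝓡 m) ∞ M]

namespace GenAlmostContactPair

variable (J : GenAlmostContactPair m M)

/-- The complex-linear extension of `Φ` to a fibre of `(TM ⊕ T*M)_ℂ`. -/
noncomputable def ΦC (p : M) : Complexification (Gen m M p) →ₗ[ℂ] Complexification (Gen m M p) where
  toFun := Complexification.map (J.Φ p)
  map_add' x y := by
    ext1
    · exact map_add (J.Φ p) _ _
    · exact map_add (J.Φ p) _ _
  map_smul' c x := by
    ext1 <;> simp [Complexification.map]

/-- The vector `F` in `(TM ⊕ T*M)_ℂ`. -/
noncomputable def FC (p : M) : Complexification (Gen m M p) := ⟨(J.F p, 0), 0⟩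

/-- The covector `η` in `(TM ⊕ T*M)_ℂ`. -/
noncomputable def ηC (p : M) : Complexification (Gen m M p) := ⟨(0, J.η p), 0⟩

theorem ΦC_FC (p : M) : J.ΦC p (J.FC p) = 0 := by
  ext1
  · exact J.Φ_F p
  · exact map_zero (J.Φ p)

theorem ΦC_ηC (p : M) : J.ΦC p (J.ηC p) = 0 := by
  ext1
  · exact J.Φ_η p
  · exact map_zero (J.Φ p)

theorem cp_FC {p : M} (x : Complexification (Gen m M p)) :
    cp x (J.FC p) = ⟨1 / 2 * x.re.2 (J.F p), 1 / 2 * x.im.2 (J.F p)⟩ := by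
  apply Complex.ext <;> simp [cp_apply, cPairing, Complexification.bilin, FC, pairing]

theorem cp_ηC {p : M} (x : Complexification (Gen m M p)) :
    cp x (J.ηC p) = ⟨1 / 2 * J.η p x.re.1, 1 / 2 * J.η p x.im.1⟩ := by
  apply Complex.ext <;> simp [cp_apply, cPairing, Complexification.bilin, ηC, pairing]

theorem cp_FC_ηC (p : M) : cp (J.FC p) (J.ηC p) = 1 / 2 := by
  rw [cp_ηC]
  apply Complex.ext <;> simp [FC, J.η_F]

theorem cp_FC_FC (p : M) : cp (J.FC p) (J.FC p) = 0 := by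
  rw [cp_FC]
  apply Complex.ext <;> simp [FC]

theorem cp_ηC_ηC (p : M) : cp (J.ηC p) (J.ηC p) = 0 := by
  rw [cp_ηC]
  apply Complex.ext <;> simp [ηC]

theorem cp_ΦC {p : M} (x y : Complexification (Gen m M p)) :
    cp (J.ΦC p x) y = -cp x (J.ΦC p y) := by
  have h : ∀ u v : Gen m M p, pairing (J.Φ p u) v = -pairing u (J.Φ p v) := fun u v =>
    eq_neg_of_add_eq_zero_left (J.skew p u v)
  apply Complex.ext <;>
    simp [cp_apply, cPairing, Complexification.bilin, ΦC, Complexification.map, h] <;> ring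

theorem ΦC_ΦC {p : M} (x : Complexification (Gen m M p)) :
    J.ΦC p (J.ΦC p x) =
      -x + ((2 * cp x (J.ηC p)) • J.FC p + (2 * cp x (J.FC p)) • J.ηC p) := by
  rw [cp_FC, cp_ηC]
  ext1
  · refine (J.Φ_sq p x.re).trans ?_
    refine Prod.ext ?_ ?_ <;> simp [FC, ηC]
  · refine (J.Φ_sq p x.im).trans ?_
    refine Prod.ext ?_ ?_ <;> simp [FC, ηC]

/-- `E^{(1,0)}` is the eigenbundle of `Φ` for the eigenvalue `i`. -/
theorem mem_E10_iff {p : M} (x : Complexification (Gen m M p)) :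
    x ∈ J.E10 p ↔ J.ΦC p x = Complex.I • x := by
  constructor
  · rintro ⟨e, he, rfl⟩
    ext1
    · simp only [ΦC, Complexification.map, LinearMap.coe_mk, AddHom.coe_mk,
        Complexification.smul_re, Complex.I_re, Complex.I_im]
      module
    · simp [ΦC, Complexification.map, J.Φ_Φ he]
  · intro h
    have h1 : J.Φ p x.re = (Complex.I • x).re := congrArg Complexification.re h
    have h2 : J.Φ p x.im = (Complex.I • x).im := congrArg Complexification.im h
    simp only [Complexification.smul_re, Complexification.smul_im, Complex.I_re, Complex.I_im,
      zero_smul, one_smul, zero_sub, zero_add] at h1 h2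
    refine ⟨x.re, h2 ▸ J.Φ_mem_kerSum x.im, ?_⟩
    ext1
    · rfl
    · rw [h1]; simp

/-- `E^{(0,1)}` is the eigenbundle of `Φ` for the eigenvalue `-i`. -/
theorem mem_E01_iff {p : M} (x : Complexification (Gen m M p)) :
    x ∈ J.E01 p ↔ J.ΦC p x = -(Complex.I • x) := by
  constructor
  · rintro ⟨e, he, rfl⟩
    ext1
    · simp [ΦC, Complexification.map]
    · simp [ΦC, Complexification.map, J.Φ_Φ he]
  · intro h
    have h1 : J.Φ p x.re = (-(Complex.I • x)).re := congrArg Complexification.re h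
    have h2 : J.Φ p x.im = (-(Complex.I • x)).im := congrArg Complexification.im h
    simp only [Complexification.smul_re, Complexification.smul_im, Complex.I_re, Complex.I_im,
      zero_smul, one_smul, zero_sub, zero_add, Complexification.neg_re, Complexification.neg_im,
      neg_neg] at h1 h2
    have h3 : x.re = J.Φ p (-x.im) := by rw [map_neg, h2, neg_neg]
    refine ⟨x.re, h3 ▸ J.Φ_mem_kerSum (-x.im), ?_⟩
    ext1
    · rfl
    · rw [h1]; simp

/-- The projection onto `E^{(1,0)}` along `E^{(0,1)}`, `L_F` and `L_η`: the polynomial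
`-½ (Φ² + i Φ)` takes the values `1`, `0`, `0` at the eigenvalues `i`, `-i`, `0`. -/
noncomputable def prA (p : M) (x : Complexification (Gen m M p)) : Complexification (Gen m M p) :=
  (1 / 2 : ℂ) • (-J.ΦC p (J.ΦC p x) - Complex.I • J.ΦC p x)

/-- The projection onto `E^{(0,1)}` along `E^{(1,0)}`, `L_F` and `L_η`, namely
`-½ (Φ² - i Φ)`. -/
noncomputable def prB (p : M) (x : Complexification (Gen m M p)) : Complexification (Gen m M p) :=
  (1 / 2 : ℂ) • (-J.ΦC p (J.ΦC p x) + Complex.I • J.ΦC p x)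

theorem ΦC_ΦC_ΦC {p : M} (x : Complexification (Gen m M p)) :
    J.ΦC p (J.ΦC p (J.ΦC p x)) = -J.ΦC p x := by
  rw [J.ΦC_ΦC x, map_add, map_add, map_neg, map_smul, map_smul, ΦC_FC, ΦC_ηC]
  module

theorem prA_mem {p : M} (x : Complexification (Gen m M p)) : J.prA p x ∈ J.E10 p := by
  rw [mem_E10_iff, prA, map_smul, map_sub, map_neg, map_smul, ΦC_ΦC_ΦC]
  have h := I_smul_I_smul (J.ΦC p x)
  generalize J.ΦC p (J.ΦC p x) = z at *
  generalize J.ΦC p x = y at *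
  linear_combination (norm := module) (1 / 2 : ℂ) • h

theorem prB_mem {p : M} (x : Complexification (Gen m M p)) : J.prB p x ∈ J.E01 p := by
  rw [mem_E01_iff, prB, map_smul, map_add, map_neg, map_smul, ΦC_ΦC_ΦC]
  have h := I_smul_I_smul (J.ΦC p x)
  generalize J.ΦC p (J.ΦC p x) = z at *
  generalize J.ΦC p x = y at *
  linear_combination (norm := module) (1 / 2 : ℂ) • h

theorem prA_of_mem {p : M} {x : Complexification (Gen m M p)} (hx : x ∈ J.E10 p) :
    J.prA p x = x := by
  rw [mem_E10_iff] at hx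
  have h := I_smul_I_smul x
  rw [prA, hx, map_smul, hx]
  linear_combination (norm := module) -h

theorem prB_of_mem {p : M} {x : Complexification (Gen m M p)} (hx : x ∈ J.E01 p) :
    J.prB p x = x := by
  rw [mem_E01_iff] at hx
  have h := I_smul_I_smul x
  rw [prB, hx, map_neg, map_smul, hx]
  linear_combination (norm := module) -h

/-- Elements of `E^{(0,1)}` only see the component in `E^{(1,0)}`. -/
theorem cp_prA_of_mem {p : M} {x : Complexification (Gen m M p)} (hx : x ∈ J.E01 p)
    (y : Complexification (Gen m M p)) : cp x (J.prA p y) = cp x y := by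
  rw [mem_E01_iff] at hx
  have h1 : cp x (J.ΦC p y) = Complex.I * cp x y := by
    rw [← neg_neg (cp x (J.ΦC p y)), ← cp_ΦC, hx]; simp
  have h2 : cp x (J.ΦC p (J.ΦC p y)) = -cp x y := by
    rw [← neg_neg (cp x (J.ΦC p _)), ← cp_ΦC, hx]
    simp only [map_neg, LinearMap.neg_apply, map_smul, LinearMap.smul_apply, h1, smul_eq_mul,
      ← mul_assoc, Complex.I_mul_I]
    ring
  rw [prA, map_smul, map_sub, map_neg, map_smul, h1, h2, smul_eq_mul, smul_eq_mul,
    ← mul_assoc Complex.I, Complex.I_mul_I]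
  ring

/-- Elements of `E^{(1,0)}` only see the component in `E^{(0,1)}`. -/
theorem cp_prB_of_mem {p : M} {x : Complexification (Gen m M p)} (hx : x ∈ J.E10 p)
    (y : Complexification (Gen m M p)) : cp x (J.prB p y) = cp x y := by
  rw [mem_E10_iff] at hx
  have h1 : cp x (J.ΦC p y) = -(Complex.I * cp x y) := by
    rw [← neg_neg (cp x (J.ΦC p y)), ← cp_ΦC, hx]; simp
  have h2 : cp x (J.ΦC p (J.ΦC p y)) = -cp x y := by
    rw [← neg_neg (cp x (J.ΦC p _)), ← cp_ΦC, hx]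
    simp only [map_smul, LinearMap.smul_apply, h1, smul_eq_mul, ← mul_assoc, Complex.I_mul_I,
      mul_neg]
    ring
  rw [prB, map_smul, map_add, map_neg, map_smul, h1, h2, smul_eq_mul, smul_eq_mul, mul_neg,
    ← mul_assoc Complex.I, Complex.I_mul_I]
  ring

/-- The pairing in terms of the components with respect to
`E^{(1,0)} ⊕ E^{(0,1)} ⊕ L_F ⊕ L_η`. -/
theorem cp_eq_components {p : M} (x y : Complexification (Gen m M p)) :
    cp x y = cp x (J.prA p y) + cp (J.prA p x) y
      + 2 * (cp x (J.FC p) * cp y (J.ηC p) + cp x (J.ηC p) * cp y (J.FC p)) := by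
  have h1 : cp (J.ΦC p (J.ΦC p x)) y = cp x (J.ΦC p (J.ΦC p y)) := by
    rw [cp_ΦC, cp_ΦC, neg_neg]
  have h2 : cp x (J.ΦC p (J.ΦC p y)) = -cp x y + 2 * cp y (J.ηC p) * cp x (J.FC p)
      + 2 * cp y (J.FC p) * cp x (J.ηC p) := by
    rw [ΦC_ΦC]; simp [map_add]; ring
  simp only [prA, map_smul, map_sub, map_neg, LinearMap.smul_apply, LinearMap.sub_apply,
    LinearMap.neg_apply, smul_eq_mul, h1, h2, J.cp_ΦC x y]
  ring

/-- A vector orthogonal to `F` and `η` is the sum of its components in `E^{(1,0)}` and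
`E^{(0,1)}`. -/
theorem eq_prA_add_prB {p : M} (x : Complexification (Gen m M p)) (h1 : cp x (J.ηC p) = 0)
    (h2 : cp x (J.FC p) = 0) : x = J.prA p x + J.prB p x := by
  have h := J.ΦC_ΦC x
  rw [h1, h2, mul_zero, zero_smul ℂ (J.FC p), zero_smul ℂ (J.ηC p), add_zero, add_zero] at h
  rw [prA, prB, h]
  module

theorem cp_E10_FC {p : M} {x : Complexification (Gen m M p)} (hx : x ∈ J.E10 p) :
    cp x (J.FC p) = 0 := by
  rw [← J.cp_prB_of_mem hx, prB, ΦC_FC]; simp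

theorem cp_E10_ηC {p : M} {x : Complexification (Gen m M p)} (hx : x ∈ J.E10 p) :
    cp x (J.ηC p) = 0 := by
  rw [← J.cp_prB_of_mem hx, prB, ΦC_ηC]; simp

theorem cp_E01_FC {p : M} {x : Complexification (Gen m M p)} (hx : x ∈ J.E01 p) :
    cp x (J.FC p) = 0 := by
  rw [← J.cp_prA_of_mem hx, prA, ΦC_FC]; simp

theorem cp_E01_ηC {p : M} {x : Complexification (Gen m M p)} (hx : x ∈ J.E01 p) :
    cp x (J.ηC p) = 0 := by
  rw [← J.cp_prA_of_mem hx, prA, ΦC_ηC]; simp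

theorem cp_E10_E10 {p : M} {x y : Complexification (Gen m M p)} (hx : x ∈ J.E10 p)
    (hy : y ∈ J.E10 p) : cp x y = 0 := by
  have h := (J.cp_ΦC x y).symm
  rw [(J.mem_E10_iff x).1 hx, (J.mem_E10_iff y).1 hy, map_smul, map_smul, LinearMap.smul_apply,
    smul_eq_mul, ← sub_eq_zero] at h
  have h2 : -(2 * Complex.I) * cp x y = 0 := by linear_combination h
  simpa using h2

theorem cp_E01_E01 {p : M} {x y : Complexification (Gen m M p)} (hx : x ∈ J.E01 p)
    (hy : y ∈ J.E01 p) : cp x y = 0 := by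
  have h := (J.cp_ΦC x y).symm
  rw [(J.mem_E01_iff x).1 hx, (J.mem_E01_iff y).1 hy, map_neg, map_neg, map_smul, map_smul,
    LinearMap.neg_apply, LinearMap.smul_apply, smul_eq_mul, ← sub_eq_zero] at h
  have h2 : (2 * Complex.I) * cp x y = 0 := by linear_combination h
  simpa using h2

theorem inDuality : InDuality J.E10 J.E01 := by
  refine fun p => ⟨fun x hx h => ?_, fun y hy h => ?_⟩
  · refine cp_nondegenerate fun z => ?_
    rw [← J.cp_prB_of_mem hx, ← cp_eq_zero_iff]
    exact h _ (J.prB_mem z)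
  · refine cp_nondegenerate fun z => ?_
    rw [← J.cp_prA_of_mem hy, cp_comm, ← cp_eq_zero_iff]
    exact h _ (J.prA_mem z)

theorem isIsotropic_E10 : IsIsotropic J.E10 := fun s hs t ht => cFun_ext fun p => by
  rw [sPairing_apply, J.cp_E10_E10 (hs.2.2 p) (ht.2.2 p)]; rfl

theorem isIsotropic_E01 : IsIsotropic J.E01 := fun s hs t ht => cFun_ext fun p => by
  rw [sPairing_apply, J.cp_E01_E01 (hs.2.2 p) (ht.2.2 p)]; rfl

end GenAlmostContactPair

end

end GenContact

/-! ### Sections of the eigenbundles and closedness -/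

/-- Complex conjugation on the complexification of a real vector space. -/
def Complexification.conj {V : Type*} [AddCommGroup V] (x : Complexification V) :
    Complexification V := ⟨x.re, -x.im⟩

namespace GenContact

section

variable {m : ℕ} {M : Type*} [TopologicalSpace M] [ChartedSpace (EuclideanSpace ℝ (Fin m)) M]

variable [IsManifold (𝓡 m) ∞ M]

/-- A section of `TM ⊕ T*M` is smooth if and only if it is smooth as a map to the total space of the
product bundle, on which `Φ` acts smoothly. -/
theorem smoothG_iff {s : GenSection m M} : SmoothG s ↔
    ContMDiff (𝓡 m)
      ((𝓡 m).prod 𝓘(ℝ, EuclideanSpace ℝ (Fin m) × (EuclideanSpace ℝ (Fin m) →L[ℝ] ℝ))) ∞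
      (fun p => (⟨p, s p⟩ : Bundle.TotalSpace
        (EuclideanSpace ℝ (Fin m) × (EuclideanSpace ℝ (Fin m) →L[ℝ] ℝ))
        (Tan m M ×ᵇ Cot m M))) := by
  have key : ∀ p, _ ↔ _ := fun p => (contMDiffAt_prod_module_iff (n := ∞) (I := 𝓡 m) (x := p)
    (fun x => (trivializationAt (EuclideanSpace ℝ (Fin m) × (EuclideanSpace ℝ (Fin m) →L[ℝ] ℝ))
      (Tan m M ×ᵇ Cot m M) p ⟨x, s x⟩).2))
  constructor
  · intro h p
    refine (Bundle.contMDiffAt_section (E := Tan m M ×ᵇ Cot m M) p).2 ((key p).2 ⟨?_, ?_⟩)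
    · exact (Bundle.contMDiffAt_section p).1 (h.1 p)
    · exact (Bundle.contMDiffAt_section (E := Cot m M) p).1 (h.2 p)
  · intro h
    have h2 := fun p => (key p).1 ((Bundle.contMDiffAt_section (E := Tan m M ×ᵇ Cot m M) p).1 (h p))
    exact ⟨fun p => (Bundle.contMDiffAt_section p).2 (h2 p).1,
      fun p => (Bundle.contMDiffAt_section (E := Cot m M) p).2 (h2 p).2⟩

theorem SmoothCS.neg {s : CSection m M} (hs : SmoothCS s) : SmoothCS (-s) := ⟨hs.1.neg, hs.2.neg⟩

theorem SmoothCS.const_smul {s : CSection m M} (c : ℂ) (hs : SmoothCS s) : SmoothCS (c • s) :=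
  ⟨(SmoothG.smul contMDiff_const hs.1).sub (SmoothG.smul contMDiff_const hs.2),
    (SmoothG.smul contMDiff_const hs.2).add (SmoothG.smul contMDiff_const hs.1)⟩

theorem exists_smoothCS [T2Space M] (p : M) (x : Complexification (Gen m M p)) :
    ∃ s : CSection m M, SmoothCS s ∧ evalAt s p = x := by
  obtain ⟨X, hX, h1⟩ := exists_smoothV p x.re.1
  obtain ⟨Y, hY, h2⟩ := exists_smoothV p x.im.1
  obtain ⟨α, hα, h3⟩ := exists_smoothF p x.re.2
  obtain ⟨β, hβ, h4⟩ := exists_smoothF p x.im.2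
  exact ⟨⟨fun q => (X q, α q), fun q => (Y q, β q)⟩, ⟨⟨hX, hα⟩, ⟨hY, hβ⟩⟩,
    Complexification.ext (Prod.ext h1 h3) (Prod.ext h2 h4)⟩

theorem cDorfman_conj [T2Space M] {s t : CSection m M} (hs : SmoothCS s) (ht : SmoothCS t) :
    cDorfman s.conj t.conj = (cDorfman s t).conj := by
  ext1
  · simp only [cDorfman_re, Complexification.conj]
    rw [dorfman_neg_left hs.2 ht.2.neg, dorfman_neg_right hs.2 ht.2, neg_neg]
  · simp only [cDorfman_im, Complexification.conj]
    rw [dorfman_neg_left hs.2 ht.1, dorfman_neg_right hs.1 ht.2, neg_add]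

namespace GenAlmostContactPair

variable (J : GenAlmostContactPair m M)

theorem smoothG_Φ {s : GenSection m M} (hs : SmoothG s) : SmoothG (fun p => J.Φ p (s p)) :=
  smoothG_iff.2 (J.smooth_Φ.comp (smoothG_iff.1 hs))

/-- The complex-linear extension of `Φ`, acting on sections. -/
noncomputable def ΦS (s : CSection m M) : CSection m M :=
  ⟨fun p => J.Φ p (s.re p), fun p => J.Φ p (s.im p)⟩

theorem smoothCS_ΦS {s : CSection m M} (hs : SmoothCS s) : SmoothCS (J.ΦS s) :=
  ⟨J.smoothG_Φ hs.1, J.smoothG_Φ hs.2⟩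

/-- The projection of sections onto `Γ(E^{(1,0)})`. -/
noncomputable def PrA (s : CSection m M) : CSection m M :=
  (1 / 2 : ℂ) • (-J.ΦS (J.ΦS s) + -(Complex.I • J.ΦS s))

/-- The projection of sections onto `Γ(E^{(0,1)})`. -/
noncomputable def PrB (s : CSection m M) : CSection m M :=
  (1 / 2 : ℂ) • (-J.ΦS (J.ΦS s) + Complex.I • J.ΦS s)

theorem evalAt_PrA (s : CSection m M) (p : M) : evalAt (J.PrA s) p = J.prA p (evalAt s p) := by
  rw [prA, sub_eq_add_neg]; rfl

theorem evalAt_PrB (s : CSection m M) (p : M) : evalAt (J.PrB s) p = J.prB p (evalAt s p) := rfl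

theorem PrA_mem {s : CSection m M} (hs : SmoothCS s) : J.PrA s ∈ Sec J.E10 := by
  have h := ((J.smoothCS_ΦS (J.smoothCS_ΦS hs)).neg.add
    ((J.smoothCS_ΦS hs).const_smul Complex.I).neg).const_smul (1 / 2)
  exact ⟨h.1, h.2, fun p => J.evalAt_PrA s p ▸ J.prA_mem _⟩

theorem PrB_mem {s : CSection m M} (hs : SmoothCS s) : J.PrB s ∈ Sec J.E01 := by
  have h := ((J.smoothCS_ΦS (J.smoothCS_ΦS hs)).neg.add
    ((J.smoothCS_ΦS hs).const_smul Complex.I)).const_smul (1 / 2)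
  exact ⟨h.1, h.2, fun p => J.evalAt_PrB s p ▸ J.prB_mem _⟩

theorem exists_mem_sec_E10 [T2Space M] {p : M} {x : Complexification (Gen m M p)}
    (hx : x ∈ J.E10 p) : ∃ s ∈ Sec J.E10, evalAt s p = x := by
  obtain ⟨s, hs, rfl⟩ := exists_smoothCS p x
  exact ⟨J.PrA s, J.PrA_mem hs, (J.evalAt_PrA s p).trans (J.prA_of_mem hx)⟩

theorem exists_mem_sec_E01 [T2Space M] {p : M} {x : Complexification (Gen m M p)}
    (hx : x ∈ J.E01 p) : ∃ s ∈ Sec J.E01, evalAt s p = x := by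
  obtain ⟨s, hs, rfl⟩ := exists_smoothCS p x
  exact ⟨J.PrB s, J.PrB_mem hs, (J.evalAt_PrB s p).trans (J.prB_of_mem hx)⟩

theorem conj_mem_E01 {p : M} {x : Complexification (Gen m M p)} (hx : x ∈ J.E10 p) :
    x.conj ∈ J.E01 p := by
  obtain ⟨e, he, rfl⟩ := hx
  exact ⟨e, he, Complexification.ext rfl (by
    change -(_ • _) = _ • _
    module)⟩

theorem conj_mem_E10 {p : M} {x : Complexification (Gen m M p)} (hx : x ∈ J.E01 p) :
    x.conj ∈ J.E10 p := by
  obtain ⟨e, he, rfl⟩ := hx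
  exact ⟨e, he, Complexification.ext rfl (by
    change -(_ • _) = _ • _
    module)⟩

theorem conj_mem_sec_E01 {s : CSection m M} (hs : s ∈ Sec J.E10) : s.conj ∈ Sec J.E01 :=
  ⟨hs.1, hs.2.1.neg, fun p => J.conj_mem_E01 (hs.2.2 p)⟩

theorem conj_mem_sec_E10 {s : CSection m M} (hs : s ∈ Sec J.E01) : s.conj ∈ Sec J.E10 :=
  ⟨hs.1, hs.2.1.neg, fun p => J.conj_mem_E10 (hs.2.2 p)⟩

theorem cp_conj_ηC {p : M} (x : Complexification (Gen m M p)) :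
    cp x.conj (J.ηC p) = 0 ↔ cp x (J.ηC p) = 0 := by
  rw [cp_ηC, cp_ηC, Complex.ext_iff, Complex.ext_iff]
  simp [Complexification.conj]

theorem cp_conj_FC {p : M} (x : Complexification (Gen m M p)) :
    cp x.conj (J.FC p) = 0 ↔ cp x (J.FC p) = 0 := by
  rw [cp_FC, cp_FC, Complex.ext_iff, Complex.ext_iff]
  simp [Complexification.conj]

theorem mem_L_iff {p : M} {x : Complexification (Gen m M p)} :
    x ∈ J.L p ↔ ∃ c : ℂ, ∃ a ∈ J.E10 p, x = c • J.FC p + a := by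
  constructor
  · intro h
    obtain ⟨y, hy, a, ha, rfl⟩ := Submodule.mem_sup.1 h
    obtain ⟨c, rfl⟩ := Submodule.mem_span_singleton.1 hy
    exact ⟨c, a, ha, rfl⟩
  · rintro ⟨c, a, ha, rfl⟩
    exact Submodule.add_mem_sup (Submodule.mem_span_singleton.2 ⟨c, rfl⟩) ha

theorem mem_Lstar_iff {p : M} {x : Complexification (Gen m M p)} :
    x ∈ J.Lstar p ↔ ∃ c : ℂ, ∃ b ∈ J.E01 p, x = c • J.ηC p + b := by
  constructor
  · intro h
    obtain ⟨y, hy, a, ha, rfl⟩ := Submodule.mem_sup.1 h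
    obtain ⟨c, rfl⟩ := Submodule.mem_span_singleton.1 hy
    exact ⟨c, a, ha, rfl⟩
  · rintro ⟨c, a, ha, rfl⟩
    exact Submodule.add_mem_sup (Submodule.mem_span_singleton.2 ⟨c, rfl⟩) ha

theorem cp_L_FC {p : M} {x : Complexification (Gen m M p)} (hx : x ∈ J.L p) :
    cp x (J.FC p) = 0 := by
  obtain ⟨c, a, ha, rfl⟩ := J.mem_L_iff.1 hx
  rw [map_add, map_smul, LinearMap.add_apply, LinearMap.smul_apply, cp_FC_FC, J.cp_E10_FC ha]
  simp

theorem cp_Lstar_ηC {p : M} {x : Complexification (Gen m M p)} (hx : x ∈ J.Lstar p) :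
    cp x (J.ηC p) = 0 := by
  obtain ⟨c, a, ha, rfl⟩ := J.mem_Lstar_iff.1 hx
  rw [map_add, map_smul, LinearMap.add_apply, LinearMap.smul_apply, cp_ηC_ηC, J.cp_E01_ηC ha]
  simp

theorem mem_E10_of_mem_L {p : M} {x : Complexification (Gen m M p)} (hx : x ∈ J.L p)
    (h : cp x (J.ηC p) = 0) : x ∈ J.E10 p := by
  obtain ⟨c, a, ha, rfl⟩ := J.mem_L_iff.1 hx
  rw [map_add, map_smul, LinearMap.add_apply, LinearMap.smul_apply, cp_FC_ηC, J.cp_E10_ηC ha] at h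
  have hc : c = 0 := by simpa using h
  rw [hc, zero_smul ℂ (J.FC p), zero_add]
  exact ha

theorem mem_E01_of_mem_Lstar {p : M} {x : Complexification (Gen m M p)} (hx : x ∈ J.Lstar p)
    (h : cp x (J.FC p) = 0) : x ∈ J.E01 p := by
  obtain ⟨c, a, ha, rfl⟩ := J.mem_Lstar_iff.1 hx
  rw [map_add, map_smul, LinearMap.add_apply, LinearMap.smul_apply, cp_comm (J.ηC p), cp_FC_ηC,
    J.cp_E01_FC ha] at h
  have hc : c = 0 := by simpa using h
  rw [hc, zero_smul ℂ (J.ηC p), zero_add]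
  exact ha

theorem sec_E10_subset : Sec J.E10 ⊆ Sec J.L := fun _ hs =>
  ⟨hs.1, hs.2.1, fun p => Submodule.mem_sup_right (hs.2.2 p)⟩

theorem sec_E01_subset : Sec J.E01 ⊆ Sec J.Lstar := fun _ hs =>
  ⟨hs.1, hs.2.1, fun p => Submodule.mem_sup_right (hs.2.2 p)⟩

variable [T2Space M]

/-- The bracket of two sections of `E^{(1,0)}` lies in `L`, and the bracket of their conjugates,
which are sections of `E^{(0,1)}`, lies in `L*`; hence it has no component along `F`. -/
theorem IsStrong.closed_E10 {J : GenAlmostContactPair m M} (hJ : J.IsStrong) :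
    CourantClosed J.E10 := by
  intro s hs t ht
  have h1 := hJ.1 s (J.sec_E10_subset hs) t (J.sec_E10_subset ht)
  have hs' := J.conj_mem_sec_E01 hs
  have ht' := J.conj_mem_sec_E01 ht
  have h2 := hJ.2 _ (J.sec_E01_subset hs') _ (J.sec_E01_subset ht')
  rw [J.isIsotropic_E01.cCourant_eq hs' ht', cDorfman_conj (smoothCS_of_mem hs)
    (smoothCS_of_mem ht), ← J.isIsotropic_E10.cCourant_eq hs ht] at h2
  refine ⟨h1.1, h1.2.1, fun p => J.mem_E10_of_mem_L (h1.2.2 p) ?_⟩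
  exact (J.cp_conj_ηC _).1 (J.cp_Lstar_ηC (h2.2.2 p))

/-- As for `E^{(1,0)}`, with `F` and `η` exchanged. -/
theorem IsStrong.closed_E01 {J : GenAlmostContactPair m M} (hJ : J.IsStrong) :
    CourantClosed J.E01 := by
  intro s hs t ht
  have h1 := hJ.2 s (J.sec_E01_subset hs) t (J.sec_E01_subset ht)
  have hs' := J.conj_mem_sec_E10 hs
  have ht' := J.conj_mem_sec_E10 ht
  have h2 := hJ.1 _ (J.sec_E10_subset hs') _ (J.sec_E10_subset ht')
  rw [J.isIsotropic_E10.cCourant_eq hs' ht', cDorfman_conj (smoothCS_of_mem hs)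
    (smoothCS_of_mem ht), ← J.isIsotropic_E01.cCourant_eq hs ht] at h2
  refine ⟨h1.1, h1.2.1, fun p => J.mem_E01_of_mem_Lstar (h1.2.2 p) ?_⟩
  exact (J.cp_conj_FC _).1 (J.cp_L_FC (h2.2.2 p))

/-- The Lie derivative is the component in `E^{(0,1)}` of the Dorfman bracket. -/
theorem isLieDerivative_PrB {a σ : CSection m M} (ha : a ∈ Sec J.E10) (hσ : σ ∈ Sec J.E01) :
    IsLieDerivative J.E10 J.E01 a σ (J.PrB (cDorfman a σ)) := by
  have sa := smoothCS_of_mem ha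
  have ss := smoothCS_of_mem hσ
  refine ⟨J.PrB_mem (sa.cDorfman ss), fun b hb => ?_⟩
  have h : sPairing (J.PrB (cDorfman a σ)) b = sPairing (cDorfman a σ) b := cFun_ext fun p => by
    rw [sPairing_apply, sPairing_apply, evalAt_PrB, cp_comm, J.cp_prB_of_mem (hb.2.2 p), cp_comm]
  rw [h, J.isIsotropic_E10.cCourant_eq ha hb, cDeriv_sPairing sa ss (smoothCS_of_mem hb)]
  abel

end GenAlmostContactPair

end

end GenContact

/-! ### The defect of the derivation property -/

namespace GenContact

section

variable {m : ℕ} {M : Type*} [TopologicalSpace M] [ChartedSpace (EuclideanSpace ℝ (Fin m)) M]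

/-- The complex number that is the value of a complex function at a point. -/
def cval {M : Type*} (f : CFun M) (p : M) : ℂ := ⟨f.re p, f.im p⟩

theorem cval_sub {M : Type*} (f g : CFun M) (p : M) : cval (f - g) p = cval f p - cval g p := by
  apply Complex.ext
  · rw [Complex.sub_re]; exact congrFun (Complexification.sub_re f g) p
  · rw [Complex.sub_im]; exact congrFun (Complexification.sub_im f g) p

theorem cval_sPairing (s t : CSection m M) (p : M) :
    cval (sPairing s t) p = cp (evalAt s p) (evalAt t p) := rfl

theorem evalAt_fsmul (f : CFun M) (s : CSection m M) (p : M) :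
    evalAt (fsmul f s) p = cval f p • evalAt s p := rfl

theorem dForm_add_left (β : OneForm m M) (p : M) (u v w : Tan m M p) :
    dForm β p (u + v) w = dForm β p u w + dForm β p v w := by
  rw [dForm_antisymm, map_add, dForm_antisymm β p w u, dForm_antisymm β p w v]
  ring

theorem dForm_smul_left (β : OneForm m M) (p : M) (c : ℝ) (v w : Tan m M p) :
    dForm β p (c • v) w = c * dForm β p v w := by
  rw [dForm_antisymm, map_smul, dForm_antisymm β p w v, smul_eq_mul]
  ring

variable [IsManifold (𝓡 m) ∞ M]
namespace GenAlmostContactPair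

variable (J : GenAlmostContactPair m M)

/-- The complex-bilinear extension of `dη` to a fibre of `(TM ⊕ T*M)_ℂ`. -/
noncomputable def dηC {p : M} (x y : Complexification (Gen m M p)) : ℂ :=
  ⟨dForm J.η p x.re.1 y.re.1 - dForm J.η p x.im.1 y.im.1,
    dForm J.η p x.re.1 y.im.1 + dForm J.η p x.im.1 y.re.1⟩

theorem dηC_antisymm {p : M} (x y : Complexification (Gen m M p)) : J.dηC x y = -J.dηC y x := by
  apply Complex.ext
  · simp only [dηC, Complex.neg_re, dForm_antisymm J.η p y.re.1, dForm_antisymm J.η p y.im.1]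
    ring
  · simp only [dηC, Complex.neg_im, dForm_antisymm J.η p y.re.1, dForm_antisymm J.η p y.im.1]
    ring

theorem dηC_add_left {p : M} (x y z : Complexification (Gen m M p)) :
    J.dηC (x + y) z = J.dηC x z + J.dηC y z := by
  apply Complex.ext
  · simp only [dηC, Complex.add_re, Complexification.add_re, Complexification.add_im, Prod.fst_add,
      dForm_add_left]
    ring
  · simp only [dηC, Complex.add_im, Complexification.add_re, Complexification.add_im, Prod.fst_add,
      dForm_add_left]
    ring

theorem dηC_add_right {p : M} (x y z : Complexification (Gen m M p)) :
    J.dηC x (y + z) = J.dηC x y + J.dηC x z := by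
  rw [dηC_antisymm, dηC_add_left, J.dηC_antisymm y, J.dηC_antisymm z]
  ring

/-- On vector fields in `ker η` the bracket modulo `ker η` is `-dη`. -/
theorem η_mlieBracket {X Y : VField m M} (hX : SmoothV X) (hY : SmoothV Y)
    (hηX : ∀ p, J.η p (X p) = 0) (hηY : ∀ p, J.η p (Y p) = 0) (p : M) :
    J.η p (VectorField.mlieBracket (𝓡 m) X Y p) = -dForm J.η p (X p) (Y p) := by
  have h0 : ∀ Z : VField m M, derivAlong Z (0 : M → ℝ) = 0 := fun Z => funext fun p =>
    DFunLike.congr_fun (mfderiv_const (I := 𝓡 m) (I' := 𝓘(ℝ, ℝ)) (c := (0 : ℝ)) (x := p)) (Z p)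
  have hX0 : GenContact.contract X J.η = 0 := funext hηX
  have hY0 : GenContact.contract Y J.η = 0 := funext hηY
  rw [dForm_apply hX hY J.smooth_η, hX0, hY0, h0, h0]
  simp

/-- For sections orthogonal to `η`, that is, with vector part in `ker η`, the component of the
Dorfman bracket along `F` is tensorial. -/
theorem cp_cDorfman_ηC {s t : CSection m M} (hs : SmoothCS s) (ht : SmoothCS t)
    (hηs : ∀ p, cp (evalAt s p) (J.ηC p) = 0) (hηt : ∀ p, cp (evalAt t p) (J.ηC p) = 0) (p : M) :
    cp (evalAt (cDorfman s t) p) (J.ηC p) = -(1 / 2) * J.dηC (evalAt s p) (evalAt t p) := by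
  have aux : ∀ u : CSection m M, (∀ p, cp (evalAt u p) (J.ηC p) = 0) →
      (∀ p, J.η p (u.re p).1 = 0) ∧ ∀ p, J.η p (u.im p).1 = 0 := fun u hu => by
    refine ⟨fun p => ?_, fun p => ?_⟩
    · have h := congrArg Complex.re ((J.cp_ηC _).symm.trans (hu p))
      simpa [evalAt] using h
    · have h := congrArg Complex.im ((J.cp_ηC _).symm.trans (hu p))
      simpa [evalAt] using h
  obtain ⟨s1, s2⟩ := aux s hηs
  obtain ⟨t1, t2⟩ := aux t hηt
  have e1 := J.η_mlieBracket hs.1.1 ht.1.1 s1 t1 p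
  have e2 := J.η_mlieBracket hs.2.1 ht.2.1 s2 t2 p
  have e3 := J.η_mlieBracket hs.1.1 ht.2.1 s1 t2 p
  have e4 := J.η_mlieBracket hs.2.1 ht.1.1 s2 t1 p
  rw [cp_ηC]
  apply Complex.ext
  · have h : J.η p ((cDorfman s t).re p).1 =
        J.η p (VectorField.mlieBracket (𝓡 m) (vec s.re) (vec t.re) p)
          - J.η p (VectorField.mlieBracket (𝓡 m) (vec s.im) (vec t.im) p) := map_sub (J.η p) _ _
    have h' := h.trans (congrArg₂ (· - ·) e1 e2)
    simp only [dηC, evalAt]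
    simp
    linear_combination (1 / 2) * h'
  · have h : J.η p ((cDorfman s t).im p).1 =
        J.η p (VectorField.mlieBracket (𝓡 m) (vec s.re) (vec t.im) p)
          + J.η p (VectorField.mlieBracket (𝓡 m) (vec s.im) (vec t.re) p) := map_add (J.η p) _ _
    have h' := h.trans (congrArg₂ (· + ·) e3 e4)
    simp only [dηC, evalAt]
    simp
    linear_combination (1 / 2) * h'

variable [T2Space M]

/-- The value of the defect of the derivation property: the terms of `defect_eq` only see the
components of the Dorfman brackets along `F` and `η`. -/
theorem cval_defect {Lie : CSection m M → CSection m M → CSection m M}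
    (hLie : ∀ a ∈ Sec J.E10, ∀ σ ∈ Sec J.E01, IsLieDerivative J.E10 J.E01 a σ (Lie a σ))
    {a b σ τ : CSection m M} (ha : a ∈ Sec J.E10) (hb : b ∈ Sec J.E10) (hσ : σ ∈ Sec J.E01)
    (hτ : τ ∈ Sec J.E01) (p : M) :
    cval (dDual (cCourant a b) σ τ
        - (-schouten Lie b (dDual a) σ τ + schouten Lie a (dDual b) σ τ)) p =
      2 * (cp (evalAt (cDorfman b σ) p) (J.FC p) * cp (evalAt (cDorfman a τ) p) (J.ηC p)
          + cp (evalAt (cDorfman b σ) p) (J.ηC p) * cp (evalAt (cDorfman a τ) p) (J.FC p))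
        - 2 * (cp (evalAt (cDorfman a σ) p) (J.FC p) * cp (evalAt (cDorfman b τ) p) (J.ηC p)
          + cp (evalAt (cDorfman a σ) p) (J.ηC p) * cp (evalAt (cDorfman b τ) p) (J.FC p)) := by
  have key : ∀ c ∈ Sec J.E10, ∀ ν ∈ Sec J.E01, ∀ u : CSection m M, SmoothCS u →
      cp (evalAt (Lie c ν) p) (evalAt u p) =
        cp (evalAt (cDorfman c ν) p) (J.prA p (evalAt u p)) := by
    intro c hc ν hν u hu
    have h := hLie c hc ν hν
    rw [← J.cp_prA_of_mem (h.1.2.2 p), ← evalAt_PrA, ← cval_sPairing,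
      sPairing_lie J.isIsotropic_E10 hc hν h (J.PrA_mem hu), cval_sPairing]
  have comp : ∀ c ∈ Sec J.E10, ∀ ν ∈ Sec J.E01, ∀ d ∈ Sec J.E10, ∀ κ ∈ Sec J.E01,
      cval (sPairing (cDorfman c ν) (cDorfman d κ) - sPairing (Lie c ν) (cDorfman d κ)
        - sPairing (cDorfman c ν) (Lie d κ)) p =
      2 * (cp (evalAt (cDorfman c ν) p) (J.FC p) * cp (evalAt (cDorfman d κ) p) (J.ηC p)
          + cp (evalAt (cDorfman c ν) p) (J.ηC p) * cp (evalAt (cDorfman d κ) p) (J.FC p)) := by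
    intro c hc ν hν d hd κ hκ
    have h1 := (smoothCS_of_mem hc).cDorfman (smoothCS_of_mem hν)
    have h2 := (smoothCS_of_mem hd).cDorfman (smoothCS_of_mem hκ)
    rw [cval_sub, cval_sub, cval_sPairing, cval_sPairing, cval_sPairing, key c hc ν hν _ h2,
      cp_comm _ (evalAt (Lie d κ) p), key d hd κ hκ _ h1,
      cp_comm (evalAt (cDorfman d κ) p) (J.prA p _),
      J.cp_eq_components (evalAt (cDorfman c ν) p) (evalAt (cDorfman d κ) p)]
    ring
  rw [defect_eq J.isIsotropic_E10 J.isIsotropic_E01 hLie ha hb hσ hτ, cval_sub,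
    comp b hb σ hσ a ha τ hτ, comp a ha σ hσ b hb τ hτ]

end GenAlmostContactPair

end

end GenContact

/-! ### The compatibility condition and `dη` -/

namespace GenContact

section

variable {m : ℕ} {M : Type*} [TopologicalSpace M] [ChartedSpace (EuclideanSpace ℝ (Fin m)) M]
  [IsManifold (𝓡 m) ∞ M]
namespace GenAlmostContactPair

variable (J : GenAlmostContactPair m M)

theorem cp_cdGen_ηC (f : CFun M) (p : M) : cp (evalAt (cdGen f) p) (J.ηC p) = 0 := by
  rw [cp_ηC]
  apply Complex.ext
  · exact (congrArg (1 / 2 * ·) (map_zero (J.η p))).trans (mul_zero _)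
  · exact (congrArg (1 / 2 * ·) (map_zero (J.η p))).trans (mul_zero _)

theorem cp_cdGen_FC (f : CFun M) (p : M) : cp (evalAt (cdGen f) p) (J.FC p) =
    ⟨1 / 2 * dFun (m := m) f.re p (J.F p), 1 / 2 * dFun (m := m) f.im p (J.F p)⟩ :=
  J.cp_FC _

/-- If `f` vanishes at `p`, the bracket of `f a` and `σ` at `p` is a combination of `a` and of
`2⟨a, σ⟩ df`. -/
theorem exists_evalAt_cDorfman_fsmul [T2Space M] {a σ : CSection m M} (ha : SmoothCS a)
    (hσ : SmoothCS σ) {f : CFun M} (hf : SmoothC (m := m) f) {p : M} (hp : cval f p = 0) :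
    ∃ c : ℂ, evalAt (cDorfman (fsmul f a) σ) p = c • evalAt a p
      + (2 : ℂ) • evalAt (cdGen (sPairing (fsmul f a) σ)) p := by
  have hfa := ha.fsmul hf
  have h := eq_sub_of_add_eq (cDorfman_add_cDorfman hfa hσ)
  rw [cDorfman_fsmul hf hσ ha, sPairing_comm σ] at h
  refine ⟨-cval (cDeriv (anchor σ) f) p, ?_⟩
  have e : evalAt (cDorfman (fsmul f a) σ) p = evalAt (cdGen (sPairing (fsmul f a) σ)) p
      + evalAt (cdGen (sPairing (fsmul f a) σ)) p
      - (cval f p • evalAt (cDorfman σ a) p + cval (cDeriv (anchor σ) f) p • evalAt a p) := by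
    rw [h, sub_eq_add_neg, sub_eq_add_neg]; rfl
  rw [e, hp]
  module

theorem cp_cDorfman_fsmul_ηC [T2Space M] {a σ : CSection m M} (ha : a ∈ Sec J.E10)
    (hσ : SmoothCS σ) {f : CFun M} (hf : SmoothC (m := m) f) {p : M} (hp : cval f p = 0) :
    cp (evalAt (cDorfman (fsmul f a) σ) p) (J.ηC p) = 0 := by
  obtain ⟨c, hc⟩ := exists_evalAt_cDorfman_fsmul (smoothCS_of_mem ha) hσ hf hp
  rw [hc, map_add, map_smul, map_smul, LinearMap.add_apply, LinearMap.smul_apply,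
    LinearMap.smul_apply, cp_cdGen_ηC, J.cp_E10_ηC (ha.2.2 p)]
  simp

theorem cp_cDorfman_fsmul_FC [T2Space M] {a σ : CSection m M} (ha : a ∈ Sec J.E10)
    (hσ : SmoothCS σ) {h : M → ℝ} (hh : SmoothR m h) {p : M} (hp : h p = 0)
    (hF : dFun h p (J.F p) = 1) :
    cp (evalAt (cDorfman (fsmul ⟨h, 0⟩ a) σ) p) (J.FC p) = cp (evalAt a p) (evalAt σ p) := by
  have hf : SmoothC (m := m) (⟨h, 0⟩ : CFun M) := ⟨hh, contMDiff_const⟩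
  have h0 : cval (⟨h, 0⟩ : CFun M) p = 0 := Complex.ext hp rfl
  obtain ⟨c, hc⟩ := exists_evalAt_cDorfman_fsmul (smoothCS_of_mem ha) hσ hf h0
  have hs : SmoothC (m := m) (sPairing a σ) := (smoothCS_of_mem ha).sPairing hσ
  have e : ∀ q, cval (sPairing (fsmul ⟨h, 0⟩ a) σ) q = (h q : ℂ) * cval (sPairing a σ) q :=
    fun q => by
      rw [cval_sPairing, evalAt_fsmul, map_smul]; rfl
  have er : (sPairing (fsmul ⟨h, 0⟩ a) σ).re = h * (sPairing a σ).re := funext fun q => by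
    have := congrArg Complex.re (e q)
    simpa [cval] using this
  have ei : (sPairing (fsmul ⟨h, 0⟩ a) σ).im = h * (sPairing a σ).im := funext fun q => by
    have := congrArg Complex.im (e q)
    simpa [cval] using this
  have d : ∀ g : M → ℝ, SmoothR m g → dFun (m := m) (h * g) p (J.F p) = g p := fun g hg => by
    rw [dFun_mul hh hg, hp]
    change 0 * _ + g p * dFun h p (J.F p) = _
    rw [hF]; ring
  rw [hc, map_add, map_smul, map_smul, LinearMap.add_apply, LinearMap.smul_apply,
    LinearMap.smul_apply, cp_cdGen_FC, J.cp_E10_FC (ha.2.2 p), er, ei, d _ hs.1, d _ hs.2,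
    ← cval_sPairing]
  apply Complex.ext <;> simp [cval]

variable {J}

/-- `E^{(1,0)}` is closed under the bracket and orthogonal to `η`, so `dη` vanishes on it. -/
theorem IsStrong.dηC_E10_E10 [T2Space M] (hJ : J.IsStrong) {p : M}
    {x y : Complexification (Gen m M p)} (hx : x ∈ J.E10 p) (hy : y ∈ J.E10 p) :
    J.dηC x y = 0 := by
  obtain ⟨s, hs, rfl⟩ := J.exists_mem_sec_E10 hx
  obtain ⟨t, ht, rfl⟩ := J.exists_mem_sec_E10 hy
  have h := J.cp_cDorfman_ηC (smoothCS_of_mem hs) (smoothCS_of_mem ht)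
    (fun q => J.cp_E10_ηC (hs.2.2 q)) (fun q => J.cp_E10_ηC (ht.2.2 q)) p
  have h2 := hJ.closed_E10 s hs t ht
  rw [J.isIsotropic_E10.cCourant_eq hs ht] at h2
  rw [J.cp_E10_ηC (h2.2.2 p)] at h
  linear_combination 2 * h

theorem IsStrong.dηC_E01_E01 [T2Space M] (hJ : J.IsStrong) {p : M}
    {x y : Complexification (Gen m M p)} (hx : x ∈ J.E01 p) (hy : y ∈ J.E01 p) :
    J.dηC x y = 0 := by
  obtain ⟨s, hs, rfl⟩ := J.exists_mem_sec_E01 hx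
  obtain ⟨t, ht, rfl⟩ := J.exists_mem_sec_E01 hy
  have h := J.cp_cDorfman_ηC (smoothCS_of_mem hs) (smoothCS_of_mem ht)
    (fun q => J.cp_E01_ηC (hs.2.2 q)) (fun q => J.cp_E01_ηC (ht.2.2 q)) p
  have h2 := hJ.closed_E01 s hs t ht
  rw [J.isIsotropic_E01.cCourant_eq hs ht] at h2
  rw [J.cp_E01_ηC (h2.2.2 p)] at h
  linear_combination 2 * h

/-- The compatibility condition of a Lie bialgebroid, evaluated with `h a` in place of `a` for a
function `h` that vanishes at `p` and satisfies `dh(F) = 1` there, becomes algebraic. -/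
theorem dηC_mul_cp_of_isLieBialgebroid [T2Space M] (hL : IsLieBialgebroid J.E10 J.E01) {p : M}
    {x y z w : Complexification (Gen m M p)} (hx : x ∈ J.E10 p) (hy : y ∈ J.E10 p)
    (hz : z ∈ J.E01 p) (hw : w ∈ J.E01 p) :
    J.dηC y z * cp x w = cp x z * J.dηC y w := by
  obtain ⟨a, ha, rfl⟩ := J.exists_mem_sec_E10 hx
  obtain ⟨b, hb, rfl⟩ := J.exists_mem_sec_E10 hy
  obtain ⟨σ, hσ, rfl⟩ := J.exists_mem_sec_E01 hz
  obtain ⟨τ, hτ, rfl⟩ := J.exists_mem_sec_E01 hw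
  obtain ⟨Lie, hLie, hc⟩ := hL.compatible
  -- Any function with `dh(F) = 1` at `p` would do; `dh = η` is such a choice.
  obtain ⟨h, hh, hp, hd⟩ := exists_smoothR_dFun_eq (m := m) p (J.η p)
  have hF : dFun h p (J.F p) = 1 := by rw [hd, J.η_F]
  have hf : SmoothC (m := m) (⟨h, 0⟩ : CFun M) := ⟨hh, contMDiff_const⟩
  have h0 : cval (⟨h, 0⟩ : CFun M) p = 0 := Complex.ext hp rfl
  have hfa := fsmul_mem_sec hf ha
  have ss := smoothCS_of_mem hσ
  have st := smoothCS_of_mem hτ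
  have key := J.cval_defect hLie hfa hb hσ hτ p
  rw [sub_eq_zero.2 (hc _ hfa b hb σ hσ τ hτ), J.cp_cDorfman_fsmul_ηC ha ss hf h0,
    J.cp_cDorfman_fsmul_ηC ha st hf h0, J.cp_cDorfman_fsmul_FC ha ss hh hp hF,
    J.cp_cDorfman_fsmul_FC ha st hh hp hF,
    J.cp_cDorfman_ηC (smoothCS_of_mem hb) ss (fun q => J.cp_E10_ηC (hb.2.2 q))
      (fun q => J.cp_E01_ηC (hσ.2.2 q)),
    J.cp_cDorfman_ηC (smoothCS_of_mem hb) st (fun q => J.cp_E10_ηC (hb.2.2 q))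
      (fun q => J.cp_E01_ηC (hτ.2.2 q))] at key
  have hc0 : cval (0 : CFun M) p = 0 := rfl
  rw [hc0] at key
  linear_combination key

/-- A real-linear condition with values in `ℂ` on a real space of dimension at least three has a
nonzero solution. -/
theorem exists_ne_zero_of_complex (f : (Fin 3 → ℝ) →ₗ[ℝ] ℂ) : ∃ c, c ≠ 0 ∧ f c = 0 := by
  have h : LinearMap.ker f ≠ ⊥ := LinearMap.ker_ne_bot_of_finrank_lt (by simp)
  obtain ⟨c, hc, h0⟩ := (Submodule.ne_bot_iff _).1 h
  exact ⟨c, h0, hc⟩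

variable (J) in
/-- Two independent vectors `v`, `w` of `ker η` and a covector of `ker F` that does not vanish on
`v` yield three elements of `E^{(1,0)}` that are independent over `ℝ`, and hence a nonzero element
orthogonal to `z`. -/
theorem exists_mem_E10_orthogonal {p : M} {v w : Tan m M p} (hv : J.η p v = 0) (hw : J.η p w = 0)
    (hvw : dForm J.η p v w ≠ 0) (z : Complexification (Gen m M p)) :
    ∃ a ∈ J.E10 p, a ≠ 0 ∧ cp a z = 0 := by
  have hself : ∀ u, dForm J.η p u u = 0 := fun u => by
    have := dForm_antisymm J.η p u u
    linarith
  have hv0 : v ≠ 0 := by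
    rintro rfl
    exact hvw (by simpa using dForm_smul_left J.η p 0 0 w)
  obtain ⟨f, hf⟩ := exists_clm_ne_zero hv0
  have hker : ∀ e ∈ J.kerSum p,
      (⟨e, (-1 : ℝ) • J.Φ p e⟩ : Complexification (Gen m M p)) ∈ J.E10 p := fun e he => ⟨e, he, rfl⟩
  -- Correcting `f` by a multiple of `η` makes it vanish on `F` and keeps its value on `v`.
  let f' : Cot m M p := f
  let α : Cot m M p := f' - f' (J.F p) • J.η p
  have hαF : α (J.F p) = 0 := by simp [α, J.η_F]
  have hαv : α v ≠ 0 := by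
    have : α v = f v := by
      change f v - f' (J.F p) * J.η p v = f v
      rw [hv]; ring
    rwa [this]
  have h0 := hker (v, 0) ⟨hv, by simp⟩
  have h1 := hker (w, 0) ⟨hw, by simp⟩
  have h2 := hker (0, α) ⟨by simp, hαF⟩
  set a0 : Complexification (Gen m M p) := ⟨(v, 0), (-1 : ℝ) • J.Φ p (v, 0)⟩
  set a1 : Complexification (Gen m M p) := ⟨(w, 0), (-1 : ℝ) • J.Φ p (w, 0)⟩
  set a2 : Complexification (Gen m M p) := ⟨(0, α), (-1 : ℝ) • J.Φ p (0, α)⟩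
  obtain ⟨c, hc, hz⟩ := exists_ne_zero_of_complex
    (Fintype.linearCombination ℝ ![cp a0 z, cp a1 z, cp a2 z])
  rw [Fintype.linearCombination_apply, Fin.sum_univ_three] at hz
  refine ⟨(c 0 : ℂ) • a0 + (c 1 : ℂ) • a1 + (c 2 : ℂ) • a2, add_mem (add_mem
    (Submodule.smul_mem _ _ h0) (Submodule.smul_mem _ _ h1)) (Submodule.smul_mem _ _ h2),
    fun h => hc ?_, ?_⟩
  · -- A linear relation between `v` and `w` would force `dη(v, w) = 0`.
    have hre : (c 0 • v + c 1 • w : Tan m M p) = 0 ∧ c 2 • α = 0 := by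
      have h3 := congrArg Complexification.re h
      simp only [Complexification.add_re, Complexification.smul_re, Complex.ofReal_re,
        Complex.ofReal_im, zero_smul, sub_zero, a0, a1, a2] at h3
      have h4 := congrArg Prod.fst h3
      have h5 := congrArg Prod.snd h3
      exact ⟨by simpa using h4, by simpa using h5⟩
    have c2 : c 2 = 0 := by
      have : c 2 * α v = 0 := DFunLike.congr_fun hre.2 v
      exact (mul_eq_zero.1 this).resolve_right hαv
    have hz0 : ∀ u, dForm J.η p 0 u = 0 := fun u => by simpa using dForm_smul_left J.η p 0 0 u
    have c0 : c 0 = 0 := by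
      have := hz0 w
      rw [← hre.1, dForm_add_left, dForm_smul_left, dForm_smul_left, hself, mul_zero,
        add_zero] at this
      exact (mul_eq_zero.1 this).resolve_right hvw
    have c1 : c 1 = 0 := by
      have := hz0 v
      rw [← hre.1, dForm_add_left, dForm_smul_left, dForm_smul_left, hself, mul_zero,
        zero_add, dForm_antisymm] at this
      exact (mul_eq_zero.1 this).resolve_right (neg_ne_zero.2 hvw)
    funext i
    fin_cases i
    · exact c0
    · exact c1
    · exact c2
  · simp only [map_add, map_smul, LinearMap.add_apply, LinearMap.smul_apply]
    simpa using hz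

/-- If `dη(v, w) ≠ 0` for some `v`, `w` in `ker η`, then `dη` vanishes on
`E^{(1,0)} × E^{(0,1)}`; but `v` and `w` have no components outside these two bundles. -/
theorem IsStrong.dForm_eq_zero [T2Space M] (hJ : J.IsStrong)
    (hL : IsLieBialgebroid J.E10 J.E01) {p : M} {v w : Tan m M p} (hv : J.η p v = 0)
    (hw : J.η p w = 0) : dForm J.η p v w = 0 := by
  by_contra hvw
  have key : ∀ b ∈ J.E10 p, ∀ σ ∈ J.E01 p, J.dηC b σ = 0 := by
    intro b hb σ hσ
    obtain ⟨a, ha, ha0, haσ⟩ := J.exists_mem_E10_orthogonal hv hw hvw σ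
    have hτ : ∃ τ ∈ J.E01 p, cp a τ ≠ 0 := by
      by_contra hne
      push Not at hne
      exact ha0 ((J.inDuality p).1 a ha fun y hy => (cp_eq_zero_iff _ _).2 (hne y hy))
    obtain ⟨τ, hτ, hne⟩ := hτ
    have h := dηC_mul_cp_of_isLieBialgebroid hL ha hb hσ hτ
    rw [haσ, zero_mul] at h
    exact (mul_eq_zero.1 h).resolve_right hne
  have hsum : ∀ u : Tan m M p, J.η p u = 0 → (⟨(u, 0), 0⟩ : Complexification (Gen m M p)) =
      J.prA p ⟨(u, 0), 0⟩ + J.prB p ⟨(u, 0), 0⟩ := fun u hu => by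
    refine J.eq_prA_add_prB _ ?_ ?_
    · rw [cp_ηC]; apply Complex.ext <;> simp [hu]
    · rw [cp_FC]; apply Complex.ext <;> simp
  have h : J.dηC (⟨(v, 0), 0⟩ : Complexification (Gen m M p)) ⟨(w, 0), 0⟩ = 0 := by
    rw [hsum v hv, hsum w hw, dηC_add_left, dηC_add_right, dηC_add_right,
      hJ.dηC_E10_E10 (J.prA_mem _) (J.prA_mem _), hJ.dηC_E01_E01 (J.prB_mem _) (J.prB_mem _),
      key _ (J.prA_mem _) _ (J.prB_mem _), J.dηC_antisymm (J.prB p _),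
      key _ (J.prA_mem _) _ (J.prB_mem _)]
    simp
  have h2 : dForm J.η p v w - dForm J.η p 0 0 = 0 := congrArg Complex.re h
  rw [map_zero, sub_zero] at h2
  exact hvw h2

theorem IsStrong.isLieBialgebroid [T2Space M] (hJ : J.IsStrong)
    (hη : ∀ (p : M) (v w : Tan m M p), J.η p v = 0 → J.η p w = 0 → dForm J.η p v w = 0) :
    IsLieBialgebroid J.E10 J.E01 where
  left := J.isIsotropic_E10.isLieAlgebroid hJ.closed_E10
  right := J.isIsotropic_E01.isLieAlgebroid hJ.closed_E01
  duality := J.inDuality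
  compatible := by
    have hLie : ∀ a ∈ Sec J.E10, ∀ σ ∈ Sec J.E01,
        IsLieDerivative J.E10 J.E01 a σ (J.PrB (cDorfman a σ)) :=
      fun a ha σ hσ => J.isLieDerivative_PrB ha hσ
    have hker : ∀ {p : M} {x : Complexification (Gen m M p)}, cp x (J.ηC p) = 0 →
        J.η p x.re.1 = 0 ∧ J.η p x.im.1 = 0 := fun {p x} hx => by
      rw [cp_ηC, Complex.ext_iff] at hx
      simpa using hx
    have h0 : ∀ a ∈ Sec J.E10, ∀ σ ∈ Sec J.E01, ∀ p,
        cp (evalAt (cDorfman a σ) p) (J.ηC p) = 0 := by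
      intro a ha σ hσ p
      rw [J.cp_cDorfman_ηC (smoothCS_of_mem ha) (smoothCS_of_mem hσ)
        (fun q => J.cp_E10_ηC (ha.2.2 q)) (fun q => J.cp_E01_ηC (hσ.2.2 q))]
      obtain ⟨a1, a2⟩ := hker (J.cp_E10_ηC (ha.2.2 p))
      obtain ⟨s1, s2⟩ := hker (J.cp_E01_ηC (hσ.2.2 p))
      rw [dηC, hη p _ _ a1 s1, hη p _ _ a2 s2, hη p _ _ a1 s2, hη p _ _ a2 s1]
      apply Complex.ext <;> simp
    refine ⟨fun a σ => J.PrB (cDorfman a σ), hLie, fun a ha b hb σ hσ τ hτ => ?_⟩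
    refine sub_eq_zero.1 (cFun_ext fun p => ?_)
    refine (J.cval_defect hLie ha hb hσ hτ p).trans ?_
    rw [h0 a ha σ hσ, h0 a ha τ hτ, h0 b hb σ hσ, h0 b hb τ hτ]
    apply Complex.ext <;> simp

end GenAlmostContactPair

end

end GenContact

theorem mainTheorem3 {m : ℕ} (hm : Odd m) {M : Type*} [TopologicalSpace M] [T2Space M]
    [ChartedSpace (EuclideanSpace ℝ (Fin m)) M] [IsManifold (𝓡 m) ∞ M]
    (J : GenContact.GenAlmostContactPair m M) (hJ : J.IsStrong) :
    GenContact.IsLieBialgebroid J.E10 J.E01 ↔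
      ∀ (p : M) (v w : TangentSpace (𝓡 m) p),
        J.η p v = 0 → J.η p w = 0 → GenContact.dForm J.η p v w = 0 :=
  ⟨fun hL _ _ _ hv hw => hJ.dForm_eq_zero hL hv hw, fun h => hJ.isLieBialgebroid h⟩
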